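/- For a closed subspace $X$ of a Hilbert space $H$ (real or complex), denote by $X$ also the orthogonal projection of $H$ onto $X$. Given closed subspaces $Z_1,\dots,Z_K$ of $H$, indices $j_1,j_2,\dots\in\{1,\dots,K\}$ and a point $z_0\in H$, the sequence of iterates of $z_0$ is defined by $z_n=Z_{j_n}z_{n-1}$ for $n\ge 1$. (1) Every infinite-dimensional Hilbert space $H$ has five closed subspaces $Z_1,\dots,Z_5$ such that for every $0\neq z\in H$ there are indices $j_1,j_2,\dots\in\{1,\dots,5\}$ for which the sequence of iterates $z_0=z$, $z_n=Z_{j_n}z_{n-1}$, does not converge in norm. (2) More precisely, there exists a sequence $k_1,k_2,\dots\in\{1,2,3\}$ with the following property: every infinite-dimensional Hilbert space $H$, real or complex, has closed subspaces $X,Y,X_1,X_2,X_3$ such that for every $0\neq z\in H$, with $u_0=Xz$ and $v_0=XYz$, at least one of the sequences of iterates $u_n=X_{k_n}u_{n-1}$ or $v_n=X_{k_n}v_{n-1}$, $n\ge1$, does not converge in norm. -/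

import Mathlib

open Filter Topology

universe u v

/-- The orthogonal projection of a Hilbert space `H` onto a closed subspace `X`, as a bounded
operator from `H` to `H`. -/
noncomputable def closedProj {𝕜 : Type u} {H : Type v} [RCLike 𝕜] [NormedAddCommGroup H]
    [InnerProductSpace 𝕜 H] [CompleteSpace H] (X : ClosedSubmodule 𝕜 H) : H →L[𝕜] H :=
  X.toSubmodule.starProjection

/-- The iterates `z 0 = z₀`, `z (n + 1) = X (k n) (z n)` of the point `z₀` under the orthogonal
projections onto the closed subspaces `X i`. The index sequence is numbered from `0`, so that
`k n` is the `(n + 1)`-st index. -/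
noncomputable def projIterates {𝕜 : Type u} {H : Type v} {ι : Type} [RCLike 𝕜]
    [NormedAddCommGroup H] [InnerProductSpace 𝕜 H] [CompleteSpace H]
    (X : ι → ClosedSubmodule 𝕜 H) (k : ℕ → ι) (z₀ : H) : ℕ → H
  | 0 => z₀
  | n + 1 => closedProj (X (k n)) (projIterates X k z₀ n)

/-- The sequence `z` converges in norm. -/
def ConvergesInNorm {H : Type v} [NormedAddCommGroup H] (z : ℕ → H) : Prop :=
  ∃ l : H, Tendsto z atTop (𝓝 l)

/-!
### Idea of the proof

A plane spanned by two orthonormal vectors `e`, `e'` can be crossed by projections: a unit vector that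
is projected successively onto lines at angles `π / 2n, 2π / 2n, …, π / 2` travels from `e` to `e'`
and loses little norm when `n` is large. Crossing, in this way, the planes of `e b` and `e (b + 1)`
for `b = 0, 1, 2, …` with summable errors gives an orbit that visits small neighbourhoods of
infinitely many orthonormal vectors, hence diverges (`PathSystem.not_tendsto`). Only three
projections `P`, `E`, `W` are allowed, and they have to imitate all these line projections.

Inside the plane of `e b` and `e (b + 1)`, projecting onto the line at the angle of step `l` means
killing the unit normal `m` of that line. Let `P` be the projection onto the closed span of the `e b`,
and arrange that `E W E` is, on the range of `E`, a diagonal operator with eigenvalue `lam` at certain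
orthonormal vectors `q`, one for each step `(b, l)`, and `1` elsewhere, where `P q = √c m`. Then
`P (E W) ^ s`, restricted to the range of `P`, is `1 - ∑ c (1 - lam ^ s) ⟨m, ·⟩ m`, the sum being over
all steps (`PathSystem.stepOp_e`). If `lam ^ s` is close to `0` at one step and close to `1` at every
other step whose weight `c` matters, a high power `r` of this operator kills `m` and does little else
(`PathSystem.norm_runWord_stepWord_sub_le`). Steps whose weight is much smaller do not matter during
`r` repetitions. So it is enough that any two different steps of one block, or of neighbouring
blocks, have weights of very different sizes, with the eigenvalue at the heavier one so close to `1`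
that it is not felt while the lighter one is treated. Weights cannot decrease or increase along an
infinite chain of blocks, since the exponents `s` are at least `1` and the weights at most `1`;
letting odd blocks be light and even blocks heavy avoids this (`exists_schedule`).

The vectors `e b` are written down as explicit finite combinations of basis vectors
(`eVec`); the component of `e b` outside the `q`'s is what makes them orthonormal. All coefficients
are real and independent of the space, hence so is the sequence of letters. An arbitrary
infinite-dimensional space is an orthogonal sum of copies of the separable construction, all
three projections respect the copies, and `X` is spanned by one starting vector from each copy, so
every nonzero vector of `X` has a divergent orbit (`not_convergesInNorm_of_mem_start`). Finally `Y`
is spanned by the sums of pairs that match each remaining basis vector with a starting vector;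
`X Y` is then injective on the orthogonal complement of `X` (`eq_zero_of_closedProj_pair`). The
statement about five subspaces follows by putting the letters for `X` or `Y, X` in front.
-/

/-! ### Words in maps -/

/-- Apply the maps `f i` along the word `l`, starting with its first letter. -/
def runWord {ι : Type} {V : Type v} (f : ι → V → V) (l : List ι) (x : V) : V :=
  l.foldl (fun y i => f i y) x

theorem runWord_append {ι : Type} {V : Type v} (f : ι → V → V) (l l' : List ι) (x : V) :
    runWord f (l ++ l') x = runWord f l' (runWord f l x) := by
  simp [runWord, List.foldl_append]

theorem runWord_replicate_flatten {ι : Type} {V : Type v} (f : ι → V → V) (l : List ι) (n : ℕ)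
    (x : V) : runWord f (List.replicate n l).flatten x = (runWord f l)^[n] x := by
  induction n generalizing x with
  | zero => simp [runWord]
  | succ n ih =>
    rw [List.replicate_succ, List.flatten_cons, runWord_append, ih, Function.iterate_succ_apply]

theorem runWord_smul {ι : Type} {V : Type v} [NormedAddCommGroup V] [NormedSpace ℝ V]
    (f : ι → V →ₗ[ℝ] V) (l : List ι) (a : ℝ) (x : V) :
    runWord (fun i => f i) l (a • x) = a • runWord (fun i => f i) l x := by
  induction l generalizing x with
  | nil => rfl
  | cons i l ih => simpa [runWord] using ih (f i x)

theorem norm_runWord_sub_le {ι : Type} {V : Type v} [NormedAddCommGroup V] [NormedSpace ℝ V]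
    (f : ι → V →ₗ[ℝ] V) (hf : ∀ i x, ‖f i x‖ ≤ ‖x‖) (l : List ι) (x y : V) :
    ‖runWord (fun i => f i) l x - runWord (fun i => f i) l y‖ ≤ ‖x - y‖ := by
  induction l generalizing x y with
  | nil => rfl
  | cons i l ih =>
    refine (ih (f i x) (f i y)).trans ?_
    rw [← map_sub]
    exact hf i _

/-- Concatenation of infinitely many nonempty words into one sequence of letters: the word `u b` is
read between the times `t b` and `t (b + 1)`. -/
theorem exists_seq_of_words {ι : Type} (u : ℕ → List ι) (hu : ∀ b, u b ≠ []) :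
    ∃ (k : ℕ → ι) (t : ℕ → ℕ), StrictMono t ∧ t 0 = 0 ∧
      ∀ (V : Type v) (f : ι → V → V) (z : ℕ → V), (∀ n, z (n + 1) = f (k n) (z n)) →
        ∀ b, z (t (b + 1)) = runWord f (u b) (z (t b)) := by
  let pre : ℕ → List ι := fun b => Nat.rec [] (fun b l => l ++ u b) b
  have pre_succ : ∀ b, pre (b + 1) = pre b ++ u b := fun b => rfl
  have hlt : ∀ b, (pre b).length < (pre (b + 1)).length := fun b => by
    have := List.length_pos_iff.2 (hu b)
    rw [pre_succ, List.length_append]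
    omega
  have hmono : StrictMono fun b => (pre b).length := strictMono_nat_of_lt_succ hlt
  have hle : ∀ n, n < (pre (n + 1)).length := fun n => (hmono.le_apply (x := n + 1))
  have hpre : ∀ b d, pre b <+: pre (b + d) := by
    intro b d
    induction d with
    | zero => exact List.prefix_refl _
    | succ d ih => exact ih.trans (by rw [← add_assoc, pre_succ]; exact List.prefix_append _ _)
  refine ⟨fun n => (pre (n + 1))[n]'(hle n), fun b => (pre b).length, hmono, rfl, ?_⟩
  intro V f z hz b
  have hk : ∀ n (hn : n < (u b).length),
      (pre ((pre b).length + n + 1))[(pre b).length + n]'(hle _) = (u b)[n] := by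
    intro n hn
    have key : ∀ a a' m (h : m < (pre a).length) (h' : m < (pre a').length), a ≤ a' →
        (pre a)[m] = (pre a')[m] := by
      intro a a' m h h' haa
      obtain ⟨d, rfl⟩ := Nat.exists_eq_add_of_le haa
      exact (hpre a d).getElem h
    have h2 : (pre b).length + n < (pre (b + 1)).length := by
      rw [pre_succ, List.length_append]; omega
    have h3 : (pre (b + 1))[(pre b).length + n] = (u b)[n] := by
      simp [pre_succ]
    rw [← h3]
    rcases le_total ((pre b).length + n + 1) (b + 1) with h | h
    · exact key _ _ _ _ _ h
    · exact (key _ _ _ _ _ h).symm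
  have main : ∀ n, n ≤ (u b).length →
      z ((pre b).length + n) = runWord f ((u b).take n) (z (pre b).length) := by
    intro n
    induction n with
    | zero => intro _; simp [runWord]
    | succ n ih =>
      intro hn
      rw [← add_assoc, hz, ih (by omega), List.take_succ_eq_append_getElem (by omega),
        runWord_append]
      simp only [hk n (by omega)]
      rfl
  have := main _ le_rfl
  rw [List.take_length] at this
  rw [← this, ← List.length_append, ← pre_succ]

/-! ### Choice of the parameters -/

/-- The total weight with which the operator built for the index `(b, l)` with exponent `s` deviates
from the ideal one: the undamped remainder at `(b, l)` itself, and the unwanted damping at the other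
indices of the blocks `b - 1`, `b`, `b + 1`. -/
noncomputable def interference (n : ℤ → ℕ) (c lam : ℤ → ℕ → ℝ) (b : ℤ) (l s : ℕ) : ℝ :=
  c b l * lam b l ^ s + ∑ j ∈ (Finset.range (n b)).erase l, c b j * (1 - lam b j ^ s) +
    ∑ j ∈ Finset.range (n (b - 1)), c (b - 1) j * (1 - lam (b - 1) j ^ s) +
    ∑ j ∈ Finset.range (n (b + 1)), c (b + 1) j * (1 - lam (b + 1) j ^ s)

/-- Parameters of the construction. Block `b` has `n b` steps; its step `l` uses a weight `c b l`, an
eigenvalue `lam b l`, and the exponents `r b l` (outer) and `s b l` (inner). The blocks are indexed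
by `ℤ` so that every block has two neighbours. -/
structure Schedule where
  n : ℤ → ℕ
  c : ℤ → ℕ → ℝ
  lam : ℤ → ℕ → ℝ
  r : ℤ → ℕ → ℕ
  s : ℤ → ℕ → ℕ
  η : ℤ → ℝ
  n_pos : ∀ b, 0 < n b
  c_pos : ∀ b l, 0 < c b l
  c_le_one : ∀ b l, c b l ≤ 1
  c_sum : ∀ b, ∑ l ∈ Finset.range (n b), c b l ≤ 1 / 4
  lam_nonneg : ∀ b l, 0 ≤ lam b l
  lam_le_one : ∀ b l, lam b l ≤ 1
  pow_le : ∀ b, ∀ l < n b, (1 - c b l) ^ r b l ≤ η b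
  interference_le : ∀ b, ∀ l < n b, r b l * interference n c lam b l (s b l) ≤ η b
  total_le : ∀ b, n b * (10 * η b) + Real.pi ^ 2 / (4 * n b) ≤ (1 / 2) ^ (b.natAbs + 3)

/-- If no two neighbours satisfy `p`, then a sequence can be made large at the indices in `p` in
terms of its values at the neighbouring indices. -/
theorem exists_seq_ge_of_neighbors (p : ℤ → Prop) (hp : ∀ b, p b → ¬ p (b - 1) ∧ ¬ p (b + 1))
    (f : ℤ → ℕ) (g : ℤ → ℤ → ℕ → ℕ) :
    ∃ N : ℤ → ℕ, (∀ b, f b ≤ N b) ∧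
      ∀ b, p b → g b (b - 1) (N (b - 1)) ≤ N b ∧ g b (b + 1) (N (b + 1)) ≤ N b := by
  classical
  refine ⟨fun b => if p b then max (f b) (max (g b (b - 1) (f (b - 1))) (g b (b + 1) (f (b + 1))))
    else f b, fun b => ?_, fun b hb => ?_⟩
  · dsimp only
    split_ifs
    · exact le_max_left _ _
    · exact le_rfl
  · obtain ⟨h1, h2⟩ := hp b hb
    simp only [hb, h1, h2, if_true, if_false]
    simp

theorem one_sub_pow_le_inv {x y : ℝ} {k : ℕ} (hx1 : x ≤ 1) (hy : 0 < y) (h : y ≤ k * x) :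
    (1 - x) ^ k ≤ 1 / y := by
  calc (1 - x) ^ k ≤ Real.exp (-x) ^ k := by
        apply pow_le_pow_left₀ (by linarith)
        linarith [Real.add_one_le_exp (-x)]
    _ = Real.exp (-(k * x)) := by rw [← Real.exp_nat_mul]; ring_nf
    _ ≤ Real.exp (-y) := Real.exp_le_exp.2 (by linarith)
    _ = 1 / Real.exp y := by rw [Real.exp_neg, one_div]
    _ ≤ 1 / y := one_div_le_one_div_of_le hy (by linarith [Real.add_one_le_exp y])

theorem one_sub_pow_one_sub_le {x : ℝ} (hx : x ≤ 1) (k : ℕ) : 1 - (1 - x) ^ k ≤ k * x := by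
  have := one_add_mul_le_pow (a := -x) (by linarith) k
  have h2 : (1 + -x) ^ k = (1 - x) ^ k := by ring_nf
  rw [h2] at this
  linarith

theorem sum_range_le_div {n : ℕ} {f : ℕ → ℝ} {t : ℝ} (h : ∀ j < n, f j ≤ t) :
    ∑ j ∈ Finset.range n, f j ≤ n * t := by
  simpa using Finset.sum_le_card_nsmul (Finset.range n) f t
    fun j hj => h j (Finset.mem_range.1 hj)

/-- The numerical core of the choice of parameters, with `N b` and `M b` the scales that govern the
weights and the eigenvalues of block `b`. -/
theorem interference_le_of_scales (n N M : ℤ → ℕ) (η : ℤ → ℝ) (b : ℤ) (l : ℕ) (hl : l < n b)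
    (hN : ∀ b, 1 ≤ N b) (hM : ∀ b, 1 ≤ M b)
    (hN1 : 8 * (n b + 1) ≤ η b * N b)
    (hM1 : 8 * ((n b + 1) * (N b : ℝ) ^ (2 * n b)) ≤ η b * M b)
    (hnb : ∀ b', b' = b - 1 ∨ b' = b + 1 → 8 * (n b' * (N b : ℝ) ^ (2 * n b)) ≤ η b * N b' ∨
      8 * (n b' * ((N b : ℝ) ^ (2 * n b) * (M b : ℝ) ^ (2 * n b + 1))) ≤ η b * M b') :
    ((N b ^ (2 * l + 2) : ℕ) : ℝ) * interference n (fun b l => 1 / (N b : ℝ) ^ (2 * l + 1))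
      (fun b l => 1 - 1 / (M b : ℝ) ^ (2 * (n b - l))) b l (M b ^ (2 * (n b - l) + 1)) ≤ η b := by
  have hN' : ∀ b, (1 : ℝ) ≤ N b := fun b => by exact_mod_cast hN b
  have hM' : ∀ b, (1 : ℝ) ≤ M b := fun b => by exact_mod_cast hM b
  have hN0 : ∀ b, (0 : ℝ) < N b := fun b => by linarith [hN' b]
  have hM0 : ∀ b, (0 : ℝ) < M b := fun b => by linarith [hM' b]
  set r : ℝ := ((N b ^ (2 * l + 2) : ℕ) : ℝ) with hr
  set s : ℕ := M b ^ (2 * (n b - l) + 1) with hs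
  set R : ℝ := (N b : ℝ) ^ (2 * n b) with hR
  set S : ℝ := (M b : ℝ) ^ (2 * n b + 1) with hS
  have hr0 : 0 ≤ r := Nat.cast_nonneg _
  have hrR : r ≤ R := by
    rw [hr, Nat.cast_pow]
    exact pow_le_pow_right₀ (hN' b) (by omega)
  have hsS : (s : ℝ) ≤ S := by
    rw [hs, Nat.cast_pow]
    exact pow_le_pow_right₀ (hM' b) (by omega)
  have hx : ∀ b k, 1 / (M b : ℝ) ^ k ≤ 1 := fun b k => by
    rw [div_le_one (pow_pos (hM0 b) _)]; exact one_le_pow₀ (hM' b)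
  have hx0 : ∀ b k, 0 ≤ 1 / (M b : ℝ) ^ k := fun b k => by have := hM0 b; positivity
  have hc1 : ∀ b k, 1 / (N b : ℝ) ^ (2 * k + 1) ≤ 1 / N b := fun b k =>
    one_div_le_one_div_of_le (hN0 b) (le_self_pow₀ (hN' b) (by omega))
  have hcone : ∀ b k, 1 / (N b : ℝ) ^ (2 * k + 1) ≤ 1 := fun b k => by
    rw [div_le_one (pow_pos (hN0 b) _)]; exact one_le_pow₀ (hN' b)
  have hc0 : ∀ b k, 0 ≤ 1 / (N b : ℝ) ^ (2 * k + 1) := fun b k => by have := hN0 b; positivity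
  have hd0 : ∀ b k, 0 ≤ 1 - (1 - 1 / (M b : ℝ) ^ k) ^ s := fun b k => by
    have := pow_le_one₀ (n := s) (sub_nonneg.2 (hx b k)) (by linarith [hx0 b k])
    linarith
  have hd1 : ∀ b k, 1 - (1 - 1 / (M b : ℝ) ^ k) ^ s ≤ 1 := fun b k => by
    have := pow_nonneg (sub_nonneg.2 (hx b k)) s
    linarith
  have hRM : R * (1 / M b) ≤ η b / 8 / (n b + 1) := by
    rw [mul_one_div, div_le_iff₀ (hM0 b), div_mul_eq_mul_div, le_div_iff₀ (by positivity)]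
    linarith
  have hNη : 1 / (N b : ℝ) ≤ η b / 8 / (n b + 1) := by
    rw [div_le_iff₀ (hN0 b), div_mul_eq_mul_div, le_div_iff₀ (by positivity)]
    linarith
  have hηpos : 0 ≤ η b / 8 / (n b + 1) := (one_div_pos.2 (hN0 b)).le.trans hNη
  have hn1 : (n b : ℝ) * (η b / 8 / (n b + 1)) ≤ η b / 8 := by
    have h1 : ((n b : ℝ) + 1) * (η b / 8 / (n b + 1)) = η b / 8 := by field_simp
    linarith
  have h8 : η b / 8 / (n b + 1) ≤ η b / 8 := by
    have h1 : ((n b : ℝ) + 1) * (η b / 8 / (n b + 1)) = η b / 8 := by field_simp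
    have : 0 ≤ (n b : ℝ) * (η b / 8 / (n b + 1)) := by positivity
    linarith
  have t1 : r * (1 / (N b : ℝ) ^ (2 * l + 1) * (1 - 1 / (M b : ℝ) ^ (2 * (n b - l))) ^ s)
      ≤ η b / 8 := by
    have h1 : (1 - 1 / (M b : ℝ) ^ (2 * (n b - l))) ^ s ≤ 1 / M b := by
      apply one_sub_pow_le_inv (hx _ _) (hM0 b)
      rw [hs, Nat.cast_pow, pow_succ]
      have := hM0 b
      field_simp
      exact le_rfl
    calc _ ≤ R * (1 * (1 / M b)) := by
          apply mul_le_mul hrR _ _ (hr0.trans hrR)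
          · exact mul_le_mul (hcone _ _) h1 (pow_nonneg (sub_nonneg.2 (hx _ _)) _) zero_le_one
          · exact mul_nonneg (hc0 _ _) (pow_nonneg (sub_nonneg.2 (hx _ _)) _)
      _ ≤ _ := by rw [one_mul]; exact hRM.trans h8
  -- Lighter steps are negligible over `r` repetitions; heavier ones have eigenvalues near `1`.
  have t2 : r * ∑ j ∈ (Finset.range (n b)).erase l, 1 / (N b : ℝ) ^ (2 * j + 1) *
      (1 - (1 - 1 / (M b : ℝ) ^ (2 * (n b - j))) ^ s) ≤ η b / 8 := by
    refine le_trans ?_ hn1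
    rw [Finset.mul_sum]
    refine le_trans (Finset.sum_le_card_nsmul _ _ (η b / 8 / (n b + 1)) fun j hj => ?_) ?_
    · rw [Finset.mem_erase, Finset.mem_range] at hj
      rcases lt_or_gt_of_ne hj.1 with h | h
      · refine le_trans ?_ hRM
        apply mul_le_mul hrR _ (mul_nonneg (hc0 _ _) (hd0 _ _)) (hr0.trans hrR)
        calc _ ≤ 1 * (s * (1 / (M b : ℝ) ^ (2 * (n b - j)))) :=
              mul_le_mul (hcone _ _) (one_sub_pow_one_sub_le (hx _ _) _) (hd0 _ _) zero_le_one
          _ ≤ _ := by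
            rw [one_mul, mul_one_div, div_le_div_iff₀ (pow_pos (hM0 b) _) (hM0 b), hs,
              Nat.cast_pow, ← pow_succ, one_mul]
            exact pow_le_pow_right₀ (hM' b) (by omega)
      · refine le_trans ?_ hNη
        calc _ ≤ r * (1 / (N b : ℝ) ^ (2 * j + 1) * 1) := by
              gcongr
              exact hd1 _ _
          _ ≤ _ := by
            rw [mul_one, mul_one_div, div_le_div_iff₀ (pow_pos (hN0 b) _) (hN0 b), hr,
              Nat.cast_pow, ← pow_succ, one_mul]
            exact pow_le_pow_right₀ (hN' b) (by omega)
    · rw [nsmul_eq_mul]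
      apply mul_le_mul_of_nonneg_right _ hηpos
      have := Finset.card_le_card (Finset.erase_subset l (Finset.range (n b)))
      rw [Finset.card_range] at this
      exact_mod_cast this
  -- A neighbouring block is either lighter as a whole or has eigenvalues nearer to `1`.
  have t3 : ∀ b', b' = b - 1 ∨ b' = b + 1 → r * ∑ j ∈ Finset.range (n b'),
      1 / (N b' : ℝ) ^ (2 * j + 1) * (1 - (1 - 1 / (M b' : ℝ) ^ (2 * (n b' - j))) ^ s)
        ≤ η b / 8 := by
    intro b' hb'
    rcases hnb b' hb' with h | h
    · calc _ ≤ R * (n b' * (1 / N b')) := by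
            apply mul_le_mul hrR _ _ (hr0.trans hrR)
            · refine sum_range_le_div fun j _ => ?_
              calc _ ≤ 1 / (N b' : ℝ) * 1 :=
                    mul_le_mul (hc1 _ _) (hd1 _ _) (hd0 _ _) (by have := hN0 b'; positivity)
                _ = _ := mul_one _
            · exact Finset.sum_nonneg fun j _ => mul_nonneg (hc0 _ _) (hd0 _ _)
        _ ≤ _ := by
          rw [mul_one_div, mul_div_assoc', div_le_iff₀ (hN0 b')]
          linarith
    · calc _ ≤ R * (n b' * (S * (1 / M b'))) := by
            apply mul_le_mul hrR _ _ (hr0.trans hrR)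
            · refine sum_range_le_div fun j hj => ?_
              calc _ ≤ 1 * (s * (1 / (M b' : ℝ) ^ (2 * (n b' - j)))) :=
                    mul_le_mul (hcone _ _) (one_sub_pow_one_sub_le (hx _ _) _) (hd0 _ _)
                      zero_le_one
                _ ≤ _ := by
                  rw [one_mul]
                  apply mul_le_mul hsS _ (hx0 _ _) (by have := hM0 b; positivity)
                  exact one_div_le_one_div_of_le (hM0 b') (le_self_pow₀ (hM' b') (by omega))
            · exact Finset.sum_nonneg fun j _ => mul_nonneg (hc0 _ _) (hd0 _ _)
        _ ≤ _ := by
          rw [mul_one_div, mul_div_assoc', mul_div_assoc', div_le_iff₀ (hM0 b')]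
          linarith
  have t4 := t3 _ (Or.inl rfl)
  have t5 := t3 _ (Or.inr rfl)
  have hη8 : 0 ≤ η b / 8 := hηpos.trans h8
  simp only [interference]
  rw [mul_add, mul_add, mul_add]
  linarith

/-- Within a block the weights decrease quickly, so that a step hardly feels the weights of the
later steps, while for the earlier steps the damping is switched off by eigenvalues very close
to `1`. Between neighbouring blocks the same device is used, with all weights of the odd blocks
small compared to those of the even blocks. -/
theorem exists_schedule : Nonempty Schedule := by
  have hpi := Real.pi_pos
  have hε : ∀ b : ℤ, (0 : ℝ) < (1 / 2) ^ (b.natAbs + 3) := fun b => by positivity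
  have hn : ∀ b : ℤ, ∃ n : ℕ, 0 < n ∧
      Real.pi ^ 2 / (4 * n) ≤ (1 / 2) ^ (b.natAbs + 3) / 2 := by
    intro b
    obtain ⟨n, hn⟩ := exists_nat_gt (Real.pi ^ 2 / (4 * ((1 / 2) ^ (b.natAbs + 3) / 2)))
    have h0 : (0 : ℝ) < n := lt_of_le_of_lt (by positivity) hn
    refine ⟨n, by exact_mod_cast h0, ?_⟩
    rw [div_lt_iff₀ (by have := hε b; positivity)] at hn
    rw [div_le_iff₀ (by positivity)]
    linarith
  choose n hn0 hn using hn
  have hn0' : ∀ b, (0 : ℝ) < n b := fun b => by exact_mod_cast hn0 b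
  let η : ℤ → ℝ := fun b => (1 / 2) ^ (b.natAbs + 3) / (20 * n b)
  have hη : ∀ b, 0 < η b := fun b => by have := hn0' b; positivity
  have hη1 : ∀ b, η b ≤ 1 := fun b => by
    have h1 : (1 / 2 : ℝ) ^ (b.natAbs + 3) ≤ 1 := pow_le_one₀ (by norm_num) (by norm_num)
    have h2 : (1 : ℝ) ≤ n b := by exact_mod_cast hn0 b
    exact (div_le_one (by linarith)).2 (by linarith)
  have hpo : ∀ b : ℤ, Odd b → ¬ Odd (b - 1) ∧ ¬ Odd (b + 1) := fun b hb => by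
    constructor <;> rw [Int.not_odd_iff_even]
    · exact hb.sub_odd odd_one
    · exact hb.add_odd odd_one
  have hpe : ∀ b : ℤ, Even b → ¬ Even (b - 1) ∧ ¬ Even (b + 1) := fun b hb => by
    constructor <;> rw [Int.not_even_iff_odd]
    · exact hb.sub_odd odd_one
    · exact hb.add_odd odd_one
  obtain ⟨N, hNf, hNg⟩ := exists_seq_ge_of_neighbors Odd hpo
    (fun b => ⌈8 * (n b + 1) / η b⌉₊ + 1)
    (fun b b' x => ⌈8 * (n b * (x : ℝ) ^ (2 * n b')) / η b'⌉₊)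
  obtain ⟨M, hMf, hMg⟩ := exists_seq_ge_of_neighbors Even hpe
    (fun b => ⌈8 * ((n b + 1) * (N b : ℝ) ^ (2 * n b)) / η b⌉₊ + 1)
    (fun b b' x =>
      ⌈8 * (n b * ((N b' : ℝ) ^ (2 * n b') * (x : ℝ) ^ (2 * n b' + 1))) / η b'⌉₊)
  have conv : ∀ (x : ℝ) (b : ℤ) (k : ℕ), ⌈x / η b⌉₊ ≤ k → x ≤ η b * k := by
    intro x b k h
    have := (Nat.le_ceil _).trans (Nat.cast_le (α := ℝ).2 h)
    rw [div_le_iff₀ (hη b)] at this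
    linarith
  have hN : ∀ b, 1 ≤ N b := fun b => (Nat.le_add_left _ _).trans (hNf b)
  have hM : ∀ b, 1 ≤ M b := fun b => (Nat.le_add_left _ _).trans (hMf b)
  have hN1 : ∀ b, 8 * ((n b : ℝ) + 1) ≤ η b * N b := fun b =>
    conv _ _ _ ((Nat.le_succ _).trans (hNf b))
  have hM1 : ∀ b, 8 * (((n b : ℝ) + 1) * (N b : ℝ) ^ (2 * n b)) ≤ η b * M b := fun b =>
    conv _ _ _ ((Nat.le_succ _).trans (hMf b))
  have hN' : ∀ b, (1 : ℝ) ≤ N b := fun b => by exact_mod_cast hN b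
  have hM' : ∀ b, (1 : ℝ) ≤ M b := fun b => by exact_mod_cast hM b
  have hN0 : ∀ b, (0 : ℝ) < N b := fun b => by linarith [hN' b]
  have hM0 : ∀ b, (0 : ℝ) < M b := fun b => by linarith [hM' b]
  have hnb : ∀ b b', b' = b - 1 ∨ b' = b + 1 →
      8 * (n b' * (N b : ℝ) ^ (2 * n b)) ≤ η b * N b' ∨
      8 * (n b' * ((N b : ℝ) ^ (2 * n b) * (M b : ℝ) ^ (2 * n b + 1))) ≤ η b * M b' := by
    intro b b' hb'
    have hbb : b = b' + 1 ∨ b = b' - 1 := by omega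
    rcases Int.even_or_odd b' with he | ho
    · right
      rcases hbb with rfl | rfl
      · exact conv _ _ _ (hMg b' he).2
      · exact conv _ _ _ (hMg b' he).1
    · left
      rcases hbb with rfl | rfl
      · exact conv _ _ _ (hNg b' ho).2
      · exact conv _ _ _ (hNg b' ho).1
  have hNη : ∀ b, (n b + 1 : ℝ) * (1 / (N b : ℝ)) ≤ η b / 8 := fun b => by
    rw [mul_one_div, div_le_iff₀ (hN0 b)]
    linarith [hN1 b]
  exact ⟨{
    n := n
    c := fun b l => 1 / (N b : ℝ) ^ (2 * l + 1)
    lam := fun b l => 1 - 1 / (M b : ℝ) ^ (2 * (n b - l))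
    r := fun b l => N b ^ (2 * l + 2)
    s := fun b l => M b ^ (2 * (n b - l) + 1)
    η := η
    n_pos := hn0
    c_pos := fun b l => by have := hN0 b; positivity
    c_le_one := fun b l => by
      rw [div_le_one (pow_pos (hN0 b) _)]; exact one_le_pow₀ (hN' b)
    c_sum := fun b => by
      refine (sum_range_le_div fun l _ => one_div_le_one_div_of_le (hN0 b)
        (le_self_pow₀ (hN' b) (by omega))).trans ?_
      have h1 : 0 < 1 / (N b : ℝ) := one_div_pos.2 (hN0 b)
      linarith [hNη b, hη1 b]
    lam_nonneg := fun b l => by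
      rw [sub_nonneg, div_le_one (pow_pos (hM0 b) _)]; exact one_le_pow₀ (hM' b)
    lam_le_one := fun b l => by
      have := hM0 b
      have : 0 ≤ 1 / (M b : ℝ) ^ (2 * (n b - l)) := by positivity
      linarith
    pow_le := fun b l _ => by
      refine (one_sub_pow_le_inv ?_ (hN0 b) ?_).trans ?_
      · rw [div_le_one (pow_pos (hN0 b) _)]; exact one_le_pow₀ (hN' b)
      · have := hN0 b
        rw [Nat.cast_pow, mul_one_div, le_div_iff₀ (by positivity)]
        exact le_of_eq (by ring)
      · have h1 : 0 < 1 / (N b : ℝ) := one_div_pos.2 (hN0 b)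
        have := mul_pos (hn0' b) h1
        linarith [hNη b, hη b]
    interference_le := fun b l hl =>
      interference_le_of_scales n N M η b l hl hN hM (hN1 b) (hM1 b) (hnb b)
    total_le := fun b => by
      have h1 : (n b : ℝ) * (10 * η b) = (1 / 2) ^ (b.natAbs + 3) / 2 := by
        have := hn0' b
        simp only [η]
        field_simp
        norm_num
      linarith [hn b] }⟩

/-! ### Moving along an orthonormal sequence by a word in three contractions -/

/-- The angle reached after step `l` of block `b`. -/
noncomputable def Schedule.angle (σ : Schedule) (b : ℤ) (l : ℕ) : ℝ :=
  (l + 1) * (Real.pi / (2 * σ.n b))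

/-- The vector at angle `φ` in the plane of `e b` and `e (b + 1)`. -/
noncomputable def planeVec {V : Type v} [NormedAddCommGroup V] [NormedSpace ℝ V] (e : ℤ → V)
    (b : ℤ) (φ : ℝ) : V :=
  Real.cos φ • e b + Real.sin φ • e (b + 1)

/-- The vector obtained from `planeVec e b φ` by a rotation by a right angle. -/
noncomputable def planeNormal {V : Type v} [NormedAddCommGroup V] [NormedSpace ℝ V] (e : ℤ → V)
    (b : ℤ) (φ : ℝ) : V :=
  -Real.sin φ • e b + Real.cos φ • e (b + 1)

/-- What is used of the three projections `f 0`, `f 1`, `f 2`. The vectors `e b` are fixed by `f 0`;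
the vectors `q b l` are eigenvectors of `f 1 ∘ f 2` with eigenvalue `lam b l`, and `e b` differs from
a fixed vector of `f 1 ∘ f 2` by a combination of the `q b l` and `q (b - 1) l`; `f 0` maps `q b l` to
a multiple of the unit vector in the plane of `e b` and `e (b + 1)` which is normal to the direction
of angle `σ.angle b l`. -/
structure PathSystem (σ : Schedule) {V : Type v} [NormedAddCommGroup V] [NormedSpace ℝ V]
    (f : Fin 3 → V →ₗ[ℝ] V) (e : ℤ → V) (q : ℤ → ℕ → V) : Prop where
  norm_le : ∀ i x, ‖f i x‖ ≤ ‖x‖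
  norm_e : ∀ b, ‖e b‖ = 1
  one_le_norm_sub : ∀ b b', b ≠ b' → 1 ≤ ‖e b - e b'‖
  f_e : ∀ b, f 0 (e b) = e b
  f_q : ∀ b, ∀ l < σ.n b, f 0 (q b l) = √(σ.c b l) • planeNormal e b (σ.angle b l)
  g_q : ∀ b, ∀ l < σ.n b, f 1 (f 2 (q b l)) = σ.lam b l • q b l
  g_e : ∀ b, f 1 (f 2 (e b)) = e b +
    ∑ l ∈ Finset.range (σ.n b),
      (√(σ.c b l) * Real.sin (σ.angle b l) * (1 - σ.lam b l)) • q b l -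
    ∑ l ∈ Finset.range (σ.n (b - 1)),
      (√(σ.c (b - 1) l) * Real.cos (σ.angle (b - 1) l) * (1 - σ.lam (b - 1) l)) • q (b - 1) l

/-- The word which carries out step `l` of block `b`: it applies `stepOp f (σ.s b l)` as often as
`σ.r b l` says. -/
def Schedule.stepWord (σ : Schedule) (b : ℤ) (l : ℕ) : List (Fin 3) :=
  (List.replicate (σ.r b l) ((List.replicate (σ.s b l) [2, 1]).flatten ++ [0])).flatten

/-- The word which carries `e b` approximately to `e (b + 1)`. The leading letter `0` fixes `e b`; it
also turns the starting vector of the orbit into a multiple of `e 0`. -/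
def Schedule.blockWord (σ : Schedule) (b : ℤ) : List (Fin 3) :=
  0 :: (List.range (σ.n b)).flatMap (σ.stepWord b)

/-- The operator `f 0 ∘ (f 1 ∘ f 2) ^ s`. -/
def stepOp {V : Type v} [NormedAddCommGroup V] [NormedSpace ℝ V] (f : Fin 3 → V →ₗ[ℝ] V) (s : ℕ) :
    V →ₗ[ℝ] V :=
  f 0 ∘ₗ (f 1 ∘ₗ f 2) ^ s

namespace PathSystem

variable {σ : Schedule} {V : Type v} [NormedAddCommGroup V] [NormedSpace ℝ V]
  {f : Fin 3 → V →ₗ[ℝ] V} {e : ℤ → V} {q : ℤ → ℕ → V}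

theorem norm_stepOp_le (h : PathSystem σ f e q) (s : ℕ) (x : V) : ‖stepOp f s x‖ ≤ ‖x‖ := by
  have : ∀ s, ‖((f 1 ∘ₗ f 2) ^ s) x‖ ≤ ‖x‖ := by
    intro s
    induction s with
    | zero => simp
    | succ s ih =>
      rw [pow_succ']
      exact ((h.norm_le 1 _).trans (h.norm_le 2 _)).trans ih
  exact (h.norm_le 0 _).trans (this s)

theorem norm_comb_le (h : PathSystem σ f e q) (b : ℤ) {x y : ℝ} (hx : |x| ≤ 1) (hy : |y| ≤ 1) :
    ‖x • e b + y • e (b + 1)‖ ≤ 2 := by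
  refine (norm_add_le _ _).trans ?_
  rw [norm_smul, norm_smul, h.norm_e, h.norm_e, Real.norm_eq_abs, Real.norm_eq_abs]
  linarith

theorem norm_planeVec_le (h : PathSystem σ f e q) (b : ℤ) (φ : ℝ) : ‖planeVec e b φ‖ ≤ 2 :=
  h.norm_comb_le b (Real.abs_cos_le_one φ) (Real.abs_sin_le_one φ)

theorem norm_planeNormal_le (h : PathSystem σ f e q) (b : ℤ) (φ : ℝ) : ‖planeNormal e b φ‖ ≤ 2 :=
  h.norm_comb_le b (by rw [abs_neg]; exact Real.abs_sin_le_one φ) (Real.abs_cos_le_one φ)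

theorem pow_g_e (h : PathSystem σ f e q) (b : ℤ) (s : ℕ) : ((f 1 ∘ₗ f 2) ^ s) (e b) = e b +
    ∑ l ∈ Finset.range (σ.n b),
      (√(σ.c b l) * Real.sin (σ.angle b l) * (1 - σ.lam b l ^ s)) • q b l -
    ∑ l ∈ Finset.range (σ.n (b - 1)),
      (√(σ.c (b - 1) l) * Real.cos (σ.angle (b - 1) l) * (1 - σ.lam (b - 1) l ^ s)) •
        q (b - 1) l := by
  induction s with
  | zero => simp
  | succ s ih =>
    have key : ∀ (b : ℤ) (w : ℕ → ℝ),
        f 1 (f 2 (∑ l ∈ Finset.range (σ.n b), (w l * (1 - σ.lam b l ^ s)) • q b l)) +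
          ∑ l ∈ Finset.range (σ.n b), (w l * (1 - σ.lam b l)) • q b l =
        ∑ l ∈ Finset.range (σ.n b), (w l * (1 - σ.lam b l ^ (s + 1))) • q b l := by
      intro b w
      rw [map_sum, map_sum, ← Finset.sum_add_distrib]
      refine Finset.sum_congr rfl fun l hl => ?_
      rw [map_smul, map_smul, h.g_q b l (Finset.mem_range.1 hl), smul_smul, ← add_smul]
      congr 1
      ring
    rw [pow_succ', Module.End.mul_apply, ih, LinearMap.comp_apply, map_sub, map_sub, map_add,
      map_add, h.g_e, ← key, ← key]
    abel

theorem stepOp_e (h : PathSystem σ f e q) (b : ℤ) (s : ℕ) : stepOp f s (e b) = e b +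
    ∑ l ∈ Finset.range (σ.n b), (σ.c b l * Real.sin (σ.angle b l) * (1 - σ.lam b l ^ s)) •
      planeNormal e b (σ.angle b l) -
    ∑ l ∈ Finset.range (σ.n (b - 1)),
      (σ.c (b - 1) l * Real.cos (σ.angle (b - 1) l) * (1 - σ.lam (b - 1) l ^ s)) •
        planeNormal e (b - 1) (σ.angle (b - 1) l) := by
  have key : ∀ (b : ℤ) (w : ℕ → ℝ) (t : ℕ → ℝ),
      f 0 (∑ l ∈ Finset.range (σ.n b), (√(σ.c b l) * w l * t l) • q b l) =
      ∑ l ∈ Finset.range (σ.n b), (σ.c b l * w l * t l) • planeNormal e b (σ.angle b l) := by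
    intro b w t
    rw [map_sum]
    refine Finset.sum_congr rfl fun l hl => ?_
    rw [map_smul, h.f_q b l (Finset.mem_range.1 hl), smul_smul]
    congr 1
    calc _ = √(σ.c b l) * √(σ.c b l) * w l * t l := by ring
      _ = _ := by rw [Real.mul_self_sqrt (σ.c_pos b l).le]
  rw [stepOp, LinearMap.comp_apply, h.pow_g_e, map_sub, map_add, h.f_e, key, key]

theorem norm_sum_planeNormal_le (h : PathSystem σ f e q) (b : ℤ) (S : Finset ℕ) (w t : ℕ → ℝ)
    (ht : ∀ l, 0 ≤ t l) (hw : ∀ l, |w l| ≤ 4) :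
    ‖∑ l ∈ S, (w l * t l) • planeNormal e b (σ.angle b l)‖ ≤ 8 * ∑ l ∈ S, t l := by
  rw [Finset.mul_sum]
  refine norm_sum_le_of_le _ fun l _ => ?_
  rw [norm_smul, Real.norm_eq_abs, abs_mul, abs_of_nonneg (ht l)]
  calc |w l| * t l * ‖planeNormal e b (σ.angle b l)‖ ≤ 4 * t l * 2 :=
        mul_le_mul (mul_le_mul_of_nonneg_right (hw l) (ht l)) (h.norm_planeNormal_le _ _)
          (norm_nonneg _) (by have := ht l; positivity)
    _ = 8 * t l := by ring

/-- On the plane of `e b` and `e (b + 1)`, the operator `stepOp f s` is, up to the interference,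
the operator which multiplies the normal direction at the angle `σ.angle b l` by `1 - σ.c b l`. -/
theorem norm_stepOp_sub_le (h : PathSystem σ f e q) (b : ℤ) (l s : ℕ) (hl : l < σ.n b) {x y : ℝ}
    (hx : |x| ≤ 2) (hy : |y| ≤ 2) :
    ‖stepOp f s (x • e b + y • e (b + 1)) - (x • e b + y • e (b + 1) +
      (σ.c b l * (x * Real.sin (σ.angle b l) - y * Real.cos (σ.angle b l))) •
        planeNormal e b (σ.angle b l))‖ ≤
      8 * interference σ.n σ.c σ.lam b l s := by
  let t : ℤ → ℕ → ℝ := fun b j => σ.c b j * (1 - σ.lam b j ^ s)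
  have ht : ∀ b j, 0 ≤ t b j := fun b j => mul_nonneg (σ.c_pos b j).le
    (sub_nonneg.2 (pow_le_one₀ (σ.lam_nonneg b j) (σ.lam_le_one b j)))
  let p : ℤ → ℕ → V := fun b j => planeNormal e b (σ.angle b j)
  let w : ℕ → ℝ := fun j => x * Real.sin (σ.angle b j) - y * Real.cos (σ.angle b j)
  have bound : ∀ {z a : ℝ}, |z| ≤ 2 → |a| ≤ 1 → |z * a| ≤ 2 := fun {z a} hz ha => by
    rw [abs_mul]
    nlinarith [abs_nonneg z, abs_nonneg a]
  have hw : ∀ j, |w j| ≤ 4 := fun j => by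
    have h1 := abs_sub (x * Real.sin (σ.angle b j)) (y * Real.cos (σ.angle b j))
    have h2 := bound hx (Real.abs_sin_le_one (σ.angle b j))
    have h3 := bound hy (Real.abs_cos_le_one (σ.angle b j))
    exact h1.trans (by linarith)
  have e1 : stepOp f s (x • e b + y • e (b + 1)) = x • e b + y • e (b + 1) +
      ∑ j ∈ Finset.range (σ.n b), (w j * t b j) • p b j +
      ∑ j ∈ Finset.range (σ.n (b - 1)),
        (-(x * Real.cos (σ.angle (b - 1) j)) * t (b - 1) j) • p (b - 1) j +
      ∑ j ∈ Finset.range (σ.n (b + 1)),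
        (y * Real.sin (σ.angle (b + 1) j) * t (b + 1) j) • p (b + 1) j := by
    have a1 : ∑ j ∈ Finset.range (σ.n b), (w j * t b j) • p b j =
        x • ∑ j ∈ Finset.range (σ.n b),
          (σ.c b j * Real.sin (σ.angle b j) * (1 - σ.lam b j ^ s)) • p b j -
        y • ∑ j ∈ Finset.range (σ.n b),
          (σ.c b j * Real.cos (σ.angle b j) * (1 - σ.lam b j ^ s)) • p b j := by
      rw [Finset.smul_sum, Finset.smul_sum, ← Finset.sum_sub_distrib]
      refine Finset.sum_congr rfl fun j _ => ?_
      rw [smul_smul, smul_smul, ← sub_smul]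
      congr 1
      simp only [w, t]
      ring
    have a2 : ∑ j ∈ Finset.range (σ.n (b - 1)),
        (-(x * Real.cos (σ.angle (b - 1) j)) * t (b - 1) j) • p (b - 1) j =
        -(x • ∑ j ∈ Finset.range (σ.n (b - 1)), (σ.c (b - 1) j *
          Real.cos (σ.angle (b - 1) j) * (1 - σ.lam (b - 1) j ^ s)) • p (b - 1) j) := by
      rw [Finset.smul_sum, ← Finset.sum_neg_distrib]
      refine Finset.sum_congr rfl fun j _ => ?_
      rw [smul_smul, ← neg_smul]
      congr 1
      simp only [t]
      ring
    have a3 : ∑ j ∈ Finset.range (σ.n (b + 1)),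
        (y * Real.sin (σ.angle (b + 1) j) * t (b + 1) j) • p (b + 1) j =
        y • ∑ j ∈ Finset.range (σ.n (b + 1)), (σ.c (b + 1) j *
          Real.sin (σ.angle (b + 1) j) * (1 - σ.lam (b + 1) j ^ s)) • p (b + 1) j := by
      rw [Finset.smul_sum]
      refine Finset.sum_congr rfl fun j _ => ?_
      rw [smul_smul]
      congr 1
      simp only [t]
      ring
    rw [a1, a2, a3, map_add, map_smul, map_smul, h.stepOp_e, h.stepOp_e, add_sub_cancel_right]
    simp only [p, smul_sub, smul_add]
    abel
  have e2 : ∑ j ∈ Finset.range (σ.n b), (w j * t b j) • p b j =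
      (w l * t b l) • p b l + ∑ j ∈ (Finset.range (σ.n b)).erase l, (w j * t b j) • p b j :=
    (Finset.add_sum_erase _ _ (Finset.mem_range.2 hl)).symm
  have e3 : (w l * t b l) • p b l = (σ.c b l * w l) • p b l +
      (-w l * (σ.c b l * σ.lam b l ^ s)) • p b l := by
    rw [← add_smul]
    congr 1
    simp only [t]
    ring
  have e4 : stepOp f s (x • e b + y • e (b + 1)) -
      (x • e b + y • e (b + 1) + (σ.c b l * w l) • p b l) =
      (-w l * (σ.c b l * σ.lam b l ^ s)) • p b l +
      ∑ j ∈ (Finset.range (σ.n b)).erase l, (w j * t b j) • p b j +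
      ∑ j ∈ Finset.range (σ.n (b - 1)),
        (-(x * Real.cos (σ.angle (b - 1) j)) * t (b - 1) j) • p (b - 1) j +
      ∑ j ∈ Finset.range (σ.n (b + 1)),
        (y * Real.sin (σ.angle (b + 1) j) * t (b + 1) j) • p (b + 1) j := by
    rw [e1, e2, e3]
    abel
  rw [e4]
  refine (norm_add₃_le.trans (add_le_add_left (add_le_add_left (norm_add_le _ _) _) _)).trans ?_
  have b1 : ‖(-w l * (σ.c b l * σ.lam b l ^ s)) • p b l‖ ≤
      8 * (σ.c b l * σ.lam b l ^ s) := by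
    have := h.norm_sum_planeNormal_le b {l} (fun j => -w j) (fun j => σ.c b j * σ.lam b j ^ s)
      (fun j => mul_nonneg (σ.c_pos b j).le (pow_nonneg (σ.lam_nonneg b j) _))
      (fun j => by rw [abs_neg]; exact hw j)
    simpa using this
  have b2 := h.norm_sum_planeNormal_le b ((Finset.range (σ.n b)).erase l) w (t b) (ht b) hw
  have b3 := h.norm_sum_planeNormal_le (b - 1) (Finset.range (σ.n (b - 1)))
    (fun j => -(x * Real.cos (σ.angle (b - 1) j))) (t (b - 1)) (ht _) fun j => by
      rw [abs_neg]
      linarith [bound hx (Real.abs_cos_le_one (σ.angle (b - 1) j))]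
  have b4 := h.norm_sum_planeNormal_le (b + 1) (Finset.range (σ.n (b + 1)))
    (fun j => y * Real.sin (σ.angle (b + 1) j)) (t (b + 1)) (ht _) fun j => by
      linarith [bound hy (Real.abs_sin_le_one (σ.angle (b + 1) j))]
  simp only [interference]
  rw [mul_add, mul_add, mul_add]
  exact add_le_add (add_le_add (add_le_add b1 b2) b3) b4

theorem runWord_stepWord (σ : Schedule) (f : Fin 3 → V →ₗ[ℝ] V) (b : ℤ) (l : ℕ) (x : V) :
    runWord (fun i => f i) (σ.stepWord b l) x = ((stepOp f (σ.s b l))^[σ.r b l]) x := by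
  rw [Schedule.stepWord, runWord_replicate_flatten]
  congr 1
  funext y
  rw [runWord_append, runWord_replicate_flatten, stepOp, LinearMap.comp_apply,
    Module.End.pow_apply]
  rfl

/-- One step: the direction in the plane of block `b` turns by `δ`, with an error of second order
in `δ`. -/
theorem norm_runWord_stepWord_sub_le (h : PathSystem σ f e q) (b : ℤ) (l : ℕ) (hl : l < σ.n b)
    (δ : ℝ) :
    ‖runWord (fun i => f i) (σ.stepWord b l) (planeVec e b (σ.angle b l - δ)) -
      planeVec e b (σ.angle b l)‖ ≤ 10 * σ.η b + δ ^ 2 := by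
  rw [runWord_stepWord]
  set T := stepOp f (σ.s b l)
  set θ := σ.angle b l
  set κ := interference σ.n σ.c σ.lam b l (σ.s b l)
  -- The ideal orbit, which stays in the plane: the normal component shrinks by `1 - c` each time.
  let y : ℕ → V := fun k =>
    Real.cos δ • planeVec e b θ - (Real.sin δ * (1 - σ.c b l) ^ k) • planeNormal e b θ
  have hc0 : 0 ≤ 1 - σ.c b l := sub_nonneg.2 (σ.c_le_one b l)
  have hc1 : ∀ k, (1 - σ.c b l) ^ k ≤ 1 := fun k =>
    pow_le_one₀ hc0 (by linarith [σ.c_pos b l])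
  have hsin : ∀ k, |Real.sin δ * (1 - σ.c b l) ^ k| ≤ (1 - σ.c b l) ^ k := fun k => by
    rw [abs_mul, abs_of_nonneg (pow_nonneg hc0 k)]
    exact mul_le_of_le_one_left (pow_nonneg hc0 k) (Real.abs_sin_le_one δ)
  have hy0 : planeVec e b (θ - δ) = y 0 := by
    simp only [y, planeVec, planeNormal, Real.cos_sub, Real.sin_sub, pow_zero, mul_one]
    module
  have hstep : ∀ k, ‖T (y k) - y (k + 1)‖ ≤ 8 * κ := by
    intro k
    have ha : ∀ a a' : ℝ, |a| ≤ 1 → |a'| ≤ 1 →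
        |Real.cos δ * a + Real.sin δ * (1 - σ.c b l) ^ k * a'| ≤ 2 := by
      intro a a' h1 h2
      refine (abs_add_le _ _).trans ?_
      rw [abs_mul, abs_mul _ a']
      have h3 := mul_le_one₀ (Real.abs_cos_le_one δ) (abs_nonneg a) h1
      have h4 := mul_le_one₀ ((hsin k).trans (hc1 k)) (abs_nonneg a') h2
      linarith
    have := h.norm_stepOp_sub_le b l (σ.s b l) hl
      (ha (Real.cos θ) (Real.sin θ) (Real.abs_cos_le_one _) (Real.abs_sin_le_one _))
      (ha (Real.sin θ) (-Real.cos θ) (Real.abs_sin_le_one _)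
        (by rw [abs_neg]; exact Real.abs_cos_le_one _))
    convert this using 2
    have hyk : y k = (Real.cos δ * Real.cos θ + Real.sin δ * (1 - σ.c b l) ^ k * Real.sin θ) • e b +
        (Real.cos δ * Real.sin θ + Real.sin δ * (1 - σ.c b l) ^ k * -Real.cos θ) • e (b + 1) := by
      simp only [y, planeVec, planeNormal]
      module
    have hcoef : (Real.cos δ * Real.cos θ + Real.sin δ * (1 - σ.c b l) ^ k * Real.sin θ) *
          Real.sin θ -
        (Real.cos δ * Real.sin θ + Real.sin δ * (1 - σ.c b l) ^ k * -Real.cos θ) * Real.cos θ =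
        Real.sin δ * (1 - σ.c b l) ^ k := by
      linear_combination (Real.sin δ * (1 - σ.c b l) ^ k) * Real.sin_sq_add_cos_sq θ
    rw [hcoef, ← hyk]
    congr 1
    simp only [y]
    rw [pow_succ]
    module
  have hiter : ∀ k, ‖(T^[k]) (y 0) - y k‖ ≤ k * (8 * κ) := by
    intro k
    induction k with
    | zero => simp
    | succ k ih =>
      rw [Function.iterate_succ_apply']
      calc ‖T ((T^[k]) (y 0)) - y (k + 1)‖
          = ‖T ((T^[k]) (y 0) - y k) + (T (y k) - y (k + 1))‖ := by rw [map_sub]; abel_nf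
        _ ≤ ‖(T^[k]) (y 0) - y k‖ + 8 * κ :=
            (norm_add_le _ _).trans (add_le_add (h.norm_stepOp_le _ _) (hstep k))
        _ ≤ _ := by push_cast; linarith
  have hend : ‖y (σ.r b l) - planeVec e b θ‖ ≤ 2 * σ.η b + δ ^ 2 := by
    have h1 : y (σ.r b l) - planeVec e b θ = (Real.cos δ - 1) • planeVec e b θ +
        (-(Real.sin δ * (1 - σ.c b l) ^ σ.r b l)) • planeNormal e b θ := by
      simp only [y]; module
    have h2 : |Real.cos δ - 1| ≤ δ ^ 2 / 2 := by
      rw [abs_le]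
      constructor
      · linarith [Real.one_sub_sq_div_two_le_cos (x := δ)]
      · nlinarith [Real.cos_le_one δ, sq_nonneg δ]
    have h3 := (hsin (σ.r b l)).trans (σ.pow_le b l hl)
    rw [h1]
    refine (norm_add_le _ _).trans ?_
    rw [norm_smul, norm_smul, Real.norm_eq_abs, Real.norm_eq_abs, abs_neg]
    have h4 := mul_le_mul h2 (h.norm_planeVec_le b θ) (norm_nonneg _) (by positivity)
    have h5 := mul_le_mul h3 (h.norm_planeNormal_le b θ) (norm_nonneg _)
      ((abs_nonneg _).trans h3)
    linarith
  have h6 : (σ.r b l : ℝ) * κ ≤ σ.η b := σ.interference_le b l hl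
  rw [hy0]
  calc _ ≤ ‖(T^[σ.r b l]) (y 0) - y (σ.r b l)‖ + ‖y (σ.r b l) - planeVec e b θ‖ :=
        norm_sub_le_norm_sub_add_norm_sub _ _ _
    _ ≤ _ := by linarith [hiter (σ.r b l)]

theorem norm_runWord_blockWord_sub_le (h : PathSystem σ f e q) (b : ℤ) :
    ‖runWord (fun i => f i) (σ.blockWord b) (e b) - e (b + 1)‖ ≤
      (1 / 2) ^ (b.natAbs + 3) := by
  set δ := Real.pi / (2 * σ.n b) with hδ
  have hn : (0 : ℝ) < σ.n b := by exact_mod_cast σ.n_pos b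
  have key : ∀ k ≤ σ.n b,
      ‖runWord (fun i => f i) ((List.range k).flatMap (σ.stepWord b)) (e b) -
        planeVec e b (k * δ)‖ ≤ k * (10 * σ.η b + δ ^ 2) := by
    intro k
    induction k with
    | zero => intro _; simp [runWord, planeVec]
    | succ k ih =>
      intro hk
      have h1 := h.norm_runWord_stepWord_sub_le b k (by omega) δ
      have h2 : σ.angle b k - δ = k * δ := by simp only [Schedule.angle, hδ]; ring
      have h3 : σ.angle b k = ((k + 1 : ℕ) : ℝ) * δ := by
        simp only [Schedule.angle, hδ]; push_cast; ring
      rw [h2, h3] at h1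
      rw [List.range_succ, List.flatMap_append, runWord_append, List.flatMap_singleton]
      refine (norm_sub_le_norm_sub_add_norm_sub _
        (runWord (fun i => f i) (σ.stepWord b k) (planeVec e b (k * δ))) _).trans ?_
      have h4 := norm_runWord_sub_le f h.norm_le (σ.stepWord b k)
        (runWord (fun i => f i) ((List.range k).flatMap (σ.stepWord b)) (e b))
        (planeVec e b (k * δ))
      have h5 := ih (by omega)
      push_cast at h1 ⊢
      linarith
  have h1 := key _ le_rfl
  have h2 : (σ.n b : ℝ) * δ = Real.pi / 2 := by rw [hδ]; field_simp
  have h3 : planeVec e b (Real.pi / 2) = e (b + 1) := by simp [planeVec]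
  have h4 : (σ.n b : ℝ) * (10 * σ.η b + δ ^ 2) =
      σ.n b * (10 * σ.η b) + Real.pi ^ 2 / (4 * σ.n b) := by rw [hδ]; field_simp; ring
  rw [h2, h3, h4] at h1
  have h5 : runWord (fun i => f i) (σ.blockWord b) (e b) =
      runWord (fun i => f i) ((List.range (σ.n b)).flatMap (σ.stepWord b)) (e b) := by
    change runWord (fun i => f i) _ (f 0 (e b)) = _
    rw [h.f_e]
  rw [h5]
  exact h1.trans (σ.total_le b)

/-- Reading the block words one after the other, an orbit that passes through a multiple of `e 0`
comes close to the same multiple of every `e b`, `b > 0`, and therefore diverges. -/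
theorem not_tendsto (h : PathSystem σ f e q) {t : ℕ → ℕ} {z : ℕ → V}
    (ht : StrictMono t) {a : ℝ} (ha : 0 < a) (h0 : f 0 (z (t 0)) = a • e 0)
    (hz : ∀ b : ℕ, z (t (b + 1)) = runWord (fun i => f i) (σ.blockWord b) (z (t b))) :
    ¬ ∃ y, Tendsto z atTop (𝓝 y) := by
  have hword : ∀ b : ℕ, ‖runWord (fun i => f i) (σ.blockWord b) (a • e b) - a • e (b + 1)‖ ≤
      a * (1 / 2) ^ (b + 3) := by
    intro b
    rw [runWord_smul, ← smul_sub, norm_smul, Real.norm_eq_abs, abs_of_pos ha]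
    exact mul_le_mul_of_nonneg_left (h.norm_runWord_blockWord_sub_le b) ha.le
  have hclose : ∀ b : ℕ, ‖z (t (b + 1)) - a • e (b + 1)‖ ≤ a * (1 / 4 - (1 / 2) ^ (b + 3)) := by
    intro b
    induction b with
    | zero =>
      have h1 : z (t (0 + 1)) = runWord (fun i => f i) (σ.blockWord (0 : ℕ)) (a • e (0 : ℕ)) := by
        rw [hz]
        change runWord (fun i => f i) _ (f 0 (z (t 0))) =
          runWord (fun i => f i) _ (f 0 (a • e (0 : ℕ)))
        rw [h0, map_smul, Nat.cast_zero, h.f_e]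
      rw [h1]
      refine (hword 0).trans (le_of_eq ?_)
      norm_num
    | succ b ih =>
      rw [hz (b + 1)]
      refine (norm_sub_le_norm_sub_add_norm_sub _
        (runWord (fun i => f i) (σ.blockWord (b + 1 : ℕ)) (a • e (b + 1 : ℕ))) _).trans ?_
      have h1 := norm_runWord_sub_le f h.norm_le (σ.blockWord (b + 1 : ℕ)) (z (t (b + 1)))
        (a • e (b + 1 : ℕ))
      have h2 := hword (b + 1)
      push_cast at h1 h2 ih ⊢
      have h3 : a * (1 / 4 - (1 / 2) ^ (b + 1 + 3)) =
          a * (1 / 4 - (1 / 2) ^ (b + 3)) + a * (1 / 2) ^ (b + 1 + 3) := by ring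
      linarith
  -- Consecutive visited vectors are at distance at least `a`, the errors sum to less than `a / 2`.
  rintro ⟨y, hy⟩
  have hsub : Tendsto (fun b : ℕ => z (t (b + 1))) atTop (𝓝 y) :=
    hy.comp (ht.tendsto_atTop.comp (tendsto_add_atTop_nat 1))
  obtain ⟨N, hN⟩ := Metric.cauchySeq_iff'.1 hsub.cauchySeq (a / 2) (by positivity)
  have h1 := hN (N + 1) (by omega)
  rw [dist_eq_norm] at h1
  have h2 := hclose N
  have h3 := hclose (N + 1)
  have h4 := h.one_le_norm_sub ((N + 1 : ℕ) + 1) (N + 1) (by push_cast; omega)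
  have h5 : ‖a • e ((N + 1 : ℕ) + 1) - a • e (N + 1)‖ = a * ‖e ((N + 1 : ℕ) + 1) - e (N + 1)‖ := by
    rw [← smul_sub, norm_smul, Real.norm_eq_abs, abs_of_pos ha]
  have h6 : ‖a • e ((N + 1 : ℕ) + 1) - a • e (N + 1)‖ ≤
      ‖z (t (N + 1 + 1)) - a • e ((N + 1 : ℕ) + 1)‖ + ‖z (t (N + 1 + 1)) - z (t (N + 1))‖ +
        ‖z (t (N + 1)) - a • e (N + 1)‖ := by
    rw [norm_sub_rev (z (t (N + 1 + 1))) (a • _)]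
    refine le_trans (le_of_eq ?_) norm_add₃_le
    congr 1
    abel
  have h7 : 0 < a * (1 / 2) ^ (N + 3) := by positivity
  have h8 : 0 < a * (1 / 2) ^ (N + 1 + 3) := by positivity
  nlinarith

end PathSystem

/-! ### Three closed subspaces realizing the path system -/

section ClosedProj

variable {𝕜 : Type u} {H : Type v} [RCLike 𝕜] [NormedAddCommGroup H] [InnerProductSpace 𝕜 H]

theorem inner_eq_zero_of_mem_closure_span {S : Set H} {x y : H} (hS : ∀ s ∈ S, inner 𝕜 x s = 0)
    (hy : y ∈ (Submodule.span 𝕜 S).closure) : inner 𝕜 x y = 0 := by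
  have h1 : x ∈ (Submodule.span 𝕜 S)ᗮ := by
    rw [Submodule.mem_orthogonal']
    intro w hw
    induction hw using Submodule.span_induction with
    | mem s hs => exact hS s hs
    | zero => simp
    | add a b _ _ ha hb => rw [inner_add_right, ha, hb, add_zero]
    | smul c a _ ha => rw [inner_smul_right, ha, mul_zero]
  rw [← Submodule.orthogonal_closure] at h1
  exact (Submodule.mem_orthogonal' _ _).1 h1 y hy

variable [CompleteSpace H]

theorem closedProj_closure_span_eq {S : Set H} {x y : H} (hy : y ∈ Submodule.span 𝕜 S)
    (hxy : ∀ s ∈ S, inner 𝕜 (x - y) s = 0) :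
    closedProj (Submodule.span 𝕜 S).closure x = y :=
  Submodule.eq_starProjection_of_mem_of_inner_eq_zero
    (Submodule.le_topologicalClosure _ hy) fun _ hw => inner_eq_zero_of_mem_closure_span hxy hw

theorem closedProj_orthogonal_closure_span_eq {S : Set H} {x y : H}
    (hy : x - y ∈ Submodule.span 𝕜 S) (hxy : ∀ s ∈ S, inner 𝕜 s y = 0) :
    closedProj (Submodule.span 𝕜 S).closureᗮ x = y := by
  refine Submodule.eq_starProjection_of_mem_of_inner_eq_zero ?_ fun w hw => ?_
  · refine (Submodule.mem_orthogonal' _ _).2 fun w hw => ?_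
    exact inner_eq_zero_of_mem_closure_span
      (fun s hs => inner_eq_zero_symm.1 (hxy s hs)) hw
  · exact (Submodule.mem_orthogonal _ _).1 hw _ (Submodule.le_topologicalClosure _ hy)

theorem norm_closedProj_le (X : ClosedSubmodule 𝕜 H) (x : H) : ‖closedProj X x‖ ≤ ‖x‖ :=
  Submodule.norm_starProjection_apply_le _ x

end ClosedProj

section Construction

variable (𝕜 : Type u) {H : Type v} [RCLike 𝕜] [NormedAddCommGroup H] [InnerProductSpace 𝕜 H]
  [NormedSpace ℝ H] [IsScalarTower ℝ 𝕜 H]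

theorem inner_coe_smul_left (r : ℝ) (x y : H) : inner 𝕜 (r • x) y = (r : 𝕜) * inner 𝕜 x y := by
  rw [RCLike.real_smul_eq_coe_smul (K := 𝕜), inner_smul_left, RCLike.conj_ofReal]

theorem inner_coe_smul_right (r : ℝ) (x y : H) : inner 𝕜 x (r • y) = (r : 𝕜) * inner 𝕜 x y := by
  rw [RCLike.real_smul_eq_coe_smul (K := 𝕜), inner_smul_right]

theorem coe_smul_mem_span {S : Set H} (r : ℝ) {x : H} (hx : x ∈ Submodule.span 𝕜 S) :
    r • x ∈ Submodule.span 𝕜 S := by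
  rw [RCLike.real_smul_eq_coe_smul (K := 𝕜)]
  exact Submodule.smul_mem _ _ hx

variable {𝕜} in
theorem closedProj_real_smul [CompleteSpace H] (X : ClosedSubmodule 𝕜 H) (r : ℝ) (x : H) :
    closedProj X (r • x) = r • closedProj X x := by
  rw [RCLike.real_smul_eq_coe_smul (K := 𝕜), map_smul, ← RCLike.real_smul_eq_coe_smul (K := 𝕜)]

variable {𝕜} in
/-- The orthogonal projection onto `X` as a real-linear map. -/
noncomputable def realProj [CompleteSpace H] (X : ClosedSubmodule 𝕜 H) : H →ₗ[ℝ] H where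
  toFun := closedProj X
  map_add' := map_add _
  map_smul' := closedProj_real_smul X

variable {𝕜} in
theorem realProj_apply [CompleteSpace H] (X : ClosedSubmodule 𝕜 H) (x : H) :
    realProj X x = closedProj X x := rfl

variable {B : Type v} (σ : Schedule) (v : B → Fin 4 → ℤ → ℕ → H)

/-- The weight left over for the last component of `eVec`. -/
noncomputable def Schedule.rest (σ : Schedule) (b : ℤ) : ℝ :=
  1 - ∑ l ∈ Finset.range (σ.n b), σ.c b l - ∑ l ∈ Finset.range (σ.n (b - 1)), σ.c (b - 1) l

theorem Schedule.rest_pos (b : ℤ) : 0 < σ.rest b := by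
  have h1 := σ.c_sum b
  have h2 := σ.c_sum (b - 1)
  rw [Schedule.rest]
  linarith

/-- The orthonormal path vectors in the copy `i`. The family `v i` is an orthonormal basis of this
copy; `v i 0 b l` and `v i 1 b l` belong to step `l` of the block `b` between `eVec σ v i b` and
`eVec σ v i (b + 1)`. -/
noncomputable def eVec (i : B) (b : ℤ) : H :=
  ∑ l ∈ Finset.range (σ.n b), √(σ.c b l) • v i 0 b l +
    ∑ l ∈ Finset.range (σ.n (b - 1)), √(σ.c (b - 1) l) • v i 1 (b - 1) l +
    √(σ.rest b) • v i 2 b 0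

/-- The eigenvectors of the compression to the second subspace of the projection onto the third. -/
noncomputable def qVec (i : B) (b : ℤ) (l : ℕ) : H :=
  -Real.sin (σ.angle b l) • v i 0 b l + Real.cos (σ.angle b l) • v i 1 b l

/-- The orthonormal vectors spanning the orthogonal complement of the third subspace. -/
noncomputable def nVec (i : B) (b : ℤ) (l : ℕ) : H :=
  √(1 - σ.lam b l) • qVec σ v i b l - √(σ.lam b l) • v i 3 b l

/-- The set of all path vectors, which span the first subspace. -/
def eSet : Set H := {x | ∃ i b, x = eVec σ v i b}

/-- The basis vectors `v i 3 b l`, which span the orthogonal complement of the second subspace. -/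
def auxSet : Set H := {x | ∃ i b l, x = v i 3 b l}

/-- The vectors `nVec σ v i b l` with `l` an actual step of block `b`; they span the orthogonal
complement of the third subspace. -/
def nSet : Set H := {x | ∃ i b l, l < σ.n b ∧ x = nVec σ v i b l}

/-- The three closed subspaces, with projections `P`, `E` and `W`. -/
noncomputable def threeSpaces : Fin 3 → ClosedSubmodule 𝕜 H :=
  ![(Submodule.span 𝕜 (eSet σ v)).closure, (Submodule.span 𝕜 (auxSet v)).closureᗮ,
    (Submodule.span 𝕜 (nSet σ v)).closureᗮ]

variable {v}
variable [DecidableEq B] (hv : ∀ i x b l i' x' b' l', inner 𝕜 (v i x b l) (v i' x' b' l') =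
  if i = i' ∧ x = x' ∧ b = b' ∧ l = l' then (1 : 𝕜) else 0)

include hv

theorem inner_zero_eVec (i j : B) (b b' : ℤ) (l : ℕ) : inner 𝕜 (v i 0 b l) (eVec σ v j b') =
    if i = j ∧ b = b' ∧ l < σ.n b then (√(σ.c b l) : 𝕜) else 0 := by
  simp only [eVec, inner_add_right, inner_sum, inner_coe_smul_right, hv]
  by_cases h1 : i = j <;> by_cases h2 : b = b' <;> simp [h1, h2]

theorem inner_one_eVec (i j : B) (b b' : ℤ) (l : ℕ) : inner 𝕜 (v i 1 b l) (eVec σ v j b') =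
    if i = j ∧ b + 1 = b' ∧ l < σ.n b then (√(σ.c b l) : 𝕜) else 0 := by
  simp only [eVec, inner_add_right, inner_sum, inner_coe_smul_right, hv]
  by_cases h1 : i = j <;> by_cases h2 : b + 1 = b'
  · subst h2; simp [h1]
  · have : b ≠ b' - 1 := by omega
    simp [h1, h2, this]
  · simp [h1]
  · simp [h1]

theorem inner_two_eVec (i j : B) (b b' : ℤ) (l : ℕ) : inner 𝕜 (v i 2 b l) (eVec σ v j b') =
    if i = j ∧ b = b' ∧ l = 0 then (√(σ.rest b) : 𝕜) else 0 := by
  simp only [eVec, inner_add_right, inner_sum, inner_coe_smul_right, hv]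
  by_cases h1 : i = j <;> by_cases h2 : b = b' <;> simp [h1, h2]

theorem inner_three_eVec (i j : B) (b b' : ℤ) (l : ℕ) :
    inner 𝕜 (v i 3 b l) (eVec σ v j b') = 0 := by
  simp [eVec, inner_add_right, inner_sum, inner_coe_smul_right, hv]

theorem inner_eVec_eVec (i j : B) (b b' : ℤ) : inner 𝕜 (eVec σ v i b) (eVec σ v j b') =
    if i = j ∧ b = b' then (1 : 𝕜) else 0 := by
  rw [eVec]
  simp only [inner_add_left, sum_inner, inner_coe_smul_left, inner_zero_eVec 𝕜 σ hv,
    inner_one_eVec 𝕜 σ hv, inner_two_eVec 𝕜 σ hv]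
  by_cases h1 : i = j ∧ b = b'
  · obtain ⟨rfl, rfl⟩ := h1
    have hs : ∀ x : ℝ, 0 ≤ x → (√x : 𝕜) * (√x : 𝕜) = (x : 𝕜) := fun x hx => by
      rw [← RCLike.ofReal_mul, Real.mul_self_sqrt hx]
    have hsum : ∀ b : ℤ, ∑ l ∈ Finset.range (σ.n b),
        (√(σ.c b l) : 𝕜) * (if l < σ.n b then (√(σ.c b l) : 𝕜) else 0) =
        ((∑ l ∈ Finset.range (σ.n b), σ.c b l : ℝ) : 𝕜) := by
      intro b
      rw [RCLike.ofReal_sum]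
      refine Finset.sum_congr rfl fun l hl => ?_
      rw [if_pos (Finset.mem_range.1 hl), hs _ (σ.c_pos b l).le]
    simp only [true_and, sub_add_cancel, and_self, if_true]
    rw [hsum, hsum, hs _ (σ.rest_pos b).le, Schedule.rest]
    push_cast
    ring
  · have h2 : ∀ p : Prop, ¬ (i = j ∧ b = b' ∧ p) := fun p h => h1 ⟨h.1, h.2.1⟩
    simp [h1, h2]

theorem inner_qVec_eVec (i j : B) (b b' : ℤ) {l : ℕ} (hl : l < σ.n b) :
    inner 𝕜 (qVec σ v i b l) (eVec σ v j b') =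
      (-√(σ.c b l) * Real.sin (σ.angle b l) : ℝ) * (if i = j ∧ b = b' then (1 : 𝕜) else 0) +
      (√(σ.c b l) * Real.cos (σ.angle b l) : ℝ) * (if i = j ∧ b + 1 = b' then (1 : 𝕜) else 0) := by
  simp only [qVec, inner_add_left, inner_coe_smul_left, inner_zero_eVec 𝕜 σ hv,
    inner_one_eVec 𝕜 σ hv, hl, and_true]
  split_ifs <;> push_cast <;> ring

theorem inner_qVec_qVec (i j : B) (b b' : ℤ) (l l' : ℕ) :
    inner 𝕜 (qVec σ v i b l) (qVec σ v j b' l') =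
      if i = j ∧ b = b' ∧ l = l' then (1 : 𝕜) else 0 := by
  simp only [qVec, inner_add_left, inner_coe_smul_left, inner_add_right, inner_coe_smul_right, hv]
  by_cases h : i = j ∧ b = b' ∧ l = l'
  · obtain ⟨rfl, rfl, rfl⟩ := h
    have : ((Real.sin (σ.angle b l) ^ 2 + Real.cos (σ.angle b l) ^ 2 : ℝ) : 𝕜) = 1 := by
      rw [Real.sin_sq_add_cos_sq, RCLike.ofReal_one]
    push_cast at this
    simp
    linear_combination this
  · simp [h]

theorem inner_three_qVec (i j : B) (b b' : ℤ) (l l' : ℕ) :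
    inner 𝕜 (v i 3 b l) (qVec σ v j b' l') = 0 := by
  simp [qVec, inner_add_right, inner_coe_smul_right, hv]

theorem inner_nVec_eVec (i j : B) (b b' : ℤ) (l : ℕ) :
    inner 𝕜 (nVec σ v i b l) (eVec σ v j b') =
      (√(1 - σ.lam b l) : 𝕜) * inner 𝕜 (qVec σ v i b l) (eVec σ v j b') := by
  rw [nVec, inner_sub_left, inner_coe_smul_left, inner_coe_smul_left, inner_three_eVec 𝕜 σ hv,
    mul_zero, sub_zero]

theorem inner_nVec_qVec (i j : B) (b b' : ℤ) (l l' : ℕ) :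
    inner 𝕜 (nVec σ v i b l) (qVec σ v j b' l') =
      (√(1 - σ.lam b l) : 𝕜) * if i = j ∧ b = b' ∧ l = l' then (1 : 𝕜) else 0 := by
  rw [nVec, inner_sub_left, inner_coe_smul_left, inner_coe_smul_left, inner_three_qVec 𝕜 σ hv,
    mul_zero, sub_zero, inner_qVec_qVec 𝕜 σ hv]

theorem inner_nVec_nVec (i j : B) (b b' : ℤ) (l l' : ℕ) :
    inner 𝕜 (nVec σ v i b l) (nVec σ v j b' l') =
      if i = j ∧ b = b' ∧ l = l' then (1 : 𝕜) else 0 := by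
  have h3 : inner 𝕜 (nVec σ v i b l) (v j 3 b' l') =
      -(√(σ.lam b l) : 𝕜) * if i = j ∧ b = b' ∧ l = l' then (1 : 𝕜) else 0 := by
    rw [nVec, inner_sub_left, inner_coe_smul_left, inner_coe_smul_left, hv,
      inner_eq_zero_symm.1 (inner_three_qVec 𝕜 σ hv j i b' b l' l)]
    simp only [true_and, mul_zero, zero_sub, neg_mul]
  conv_lhs => rw [nVec.eq_1 σ v j b' l']
  rw [inner_sub_right, inner_coe_smul_right, inner_coe_smul_right, h3, inner_nVec_qVec 𝕜 σ hv]
  by_cases h : i = j ∧ b = b' ∧ l = l'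
  · obtain ⟨rfl, rfl, rfl⟩ := h
    simp only [and_self, if_true, mul_one]
    rw [← RCLike.ofReal_mul, Real.mul_self_sqrt (sub_nonneg.2 (σ.lam_le_one b l)), mul_neg,
      ← RCLike.ofReal_mul, Real.mul_self_sqrt (σ.lam_nonneg b l)]
    push_cast
    ring
  · simp [h]

variable [CompleteSpace H]

omit [IsScalarTower ℝ 𝕜 H] [DecidableEq B] hv in
theorem closedProj_zero_eVec (i : B) (b : ℤ) :
    closedProj (threeSpaces 𝕜 σ v 0) (eVec σ v i b) = eVec σ v i b := by
  refine closedProj_closure_span_eq (Submodule.subset_span ⟨i, b, rfl⟩) fun s _ => ?_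
  rw [sub_self, inner_zero_left]

theorem closedProj_zero_qVec (i : B) (b : ℤ) {l : ℕ} (hl : l < σ.n b) :
    closedProj (threeSpaces 𝕜 σ v 0) (qVec σ v i b l) =
      √(σ.c b l) • planeNormal (eVec σ v i) b (σ.angle b l) := by
  refine closedProj_closure_span_eq (coe_smul_mem_span 𝕜 _ (add_mem
    (coe_smul_mem_span 𝕜 _ (Submodule.subset_span ⟨i, b, rfl⟩))
    (coe_smul_mem_span 𝕜 _ (Submodule.subset_span ⟨i, b + 1, rfl⟩)))) ?_
  rintro _ ⟨j, b', rfl⟩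
  rw [planeNormal, inner_sub_left, inner_qVec_eVec 𝕜 σ hv _ _ _ _ hl, inner_coe_smul_left,
    inner_add_left, inner_coe_smul_left, inner_coe_smul_left, inner_eVec_eVec 𝕜 σ hv,
    inner_eVec_eVec 𝕜 σ hv]
  push_cast
  ring

theorem closedProj_zero_two (i : B) :
    closedProj (threeSpaces 𝕜 σ v 0) (v i 2 0 0) = √(σ.rest 0) • eVec σ v i 0 := by
  refine closedProj_closure_span_eq (coe_smul_mem_span 𝕜 _ (Submodule.subset_span ⟨i, 0, rfl⟩)) ?_
  rintro _ ⟨j, b', rfl⟩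
  rw [inner_sub_left, inner_two_eVec 𝕜 σ hv, inner_coe_smul_left, inner_eVec_eVec 𝕜 σ hv]
  simp

theorem closedProj_one_eVec (i : B) (b : ℤ) :
    closedProj (threeSpaces 𝕜 σ v 1) (eVec σ v i b) = eVec σ v i b := by
  refine closedProj_orthogonal_closure_span_eq (by rw [sub_self]; exact zero_mem _) ?_
  rintro _ ⟨j, b', l', rfl⟩
  exact inner_three_eVec 𝕜 σ hv _ _ _ _ _

theorem closedProj_one_qVec (i : B) (b : ℤ) (l : ℕ) :
    closedProj (threeSpaces 𝕜 σ v 1) (qVec σ v i b l) = qVec σ v i b l := by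
  refine closedProj_orthogonal_closure_span_eq (by rw [sub_self]; exact zero_mem _) ?_
  rintro _ ⟨j, b', l', rfl⟩
  exact inner_three_qVec 𝕜 σ hv _ _ _ _ _ _

theorem closedProj_one_nVec (i : B) (b : ℤ) (l : ℕ) :
    closedProj (threeSpaces 𝕜 σ v 1) (nVec σ v i b l) = √(1 - σ.lam b l) • qVec σ v i b l := by
  refine closedProj_orthogonal_closure_span_eq ?_ ?_
  · rw [nVec, sub_sub_cancel_left]
    exact neg_mem (coe_smul_mem_span 𝕜 _ (Submodule.subset_span ⟨i, b, l, rfl⟩))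
  · rintro _ ⟨j, b', l', rfl⟩
    rw [inner_coe_smul_right, inner_three_qVec 𝕜 σ hv, mul_zero]

theorem closedProj_two_qVec (i : B) (b : ℤ) {l : ℕ} (hl : l < σ.n b) :
    closedProj (threeSpaces 𝕜 σ v 2) (qVec σ v i b l) =
      qVec σ v i b l - √(1 - σ.lam b l) • nVec σ v i b l := by
  refine closedProj_orthogonal_closure_span_eq ?_ ?_
  · rw [sub_sub_cancel]
    exact coe_smul_mem_span 𝕜 _ (Submodule.subset_span ⟨i, b, l, hl, rfl⟩)
  · rintro _ ⟨j, b', l', _, rfl⟩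
    rw [inner_sub_right, inner_coe_smul_right, inner_nVec_qVec 𝕜 σ hv, inner_nVec_nVec 𝕜 σ hv]
    by_cases h : j = i ∧ b' = b ∧ l' = l
    · obtain ⟨rfl, rfl, rfl⟩ := h; exact sub_self _
    · simp [h]

theorem closedProj_two_eVec (i : B) (b : ℤ) :
    closedProj (threeSpaces 𝕜 σ v 2) (eVec σ v i b) = eVec σ v i b +
      ∑ l ∈ Finset.range (σ.n b),
        (√(1 - σ.lam b l) * (√(σ.c b l) * Real.sin (σ.angle b l))) • nVec σ v i b l -
      ∑ l ∈ Finset.range (σ.n (b - 1)), (√(1 - σ.lam (b - 1) l) *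
        (√(σ.c (b - 1) l) * Real.cos (σ.angle (b - 1) l))) • nVec σ v i (b - 1) l := by
  have hmem : ∀ b (w : ℕ → ℝ), ∑ l ∈ Finset.range (σ.n b), w l • nVec σ v i b l ∈
      Submodule.span 𝕜 (nSet σ v) := fun b w => sum_mem fun l hl =>
    coe_smul_mem_span 𝕜 _ (Submodule.subset_span ⟨i, b, l, Finset.mem_range.1 hl, rfl⟩)
  refine closedProj_orthogonal_closure_span_eq ?_ ?_
  · rw [add_sub_assoc, sub_add_cancel_left]
    exact neg_mem (sub_mem (hmem _ _) (hmem _ _))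
  · rintro _ ⟨j, b', l', hl', rfl⟩
    have hsum : ∀ b (w : ℕ → ℝ), inner 𝕜 (nVec σ v j b' l')
        (∑ l ∈ Finset.range (σ.n b), w l • nVec σ v i b l) =
        if j = i ∧ b' = b then (w l' : 𝕜) else 0 := by
      intro b w
      simp only [inner_sum, inner_coe_smul_right, inner_nVec_nVec 𝕜 σ hv]
      by_cases h1 : j = i <;> by_cases h2 : b' = b
      · subst h1; subst h2; simp [hl']
      · simp [h2]
      · simp [h1]
      · simp [h1]
    rw [inner_sub_right, inner_add_right, hsum, hsum, inner_nVec_eVec 𝕜 σ hv,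
      inner_qVec_eVec 𝕜 σ hv _ _ _ _ hl']
    have hb : b' + 1 = b ↔ b' = b - 1 := by omega
    simp only [hb]
    by_cases h1 : j = i ∧ b' = b
    · obtain ⟨rfl, rfl⟩ := h1
      have : ¬ b' = b' - 1 := by omega
      simp [this]
    · by_cases h2 : j = i ∧ b' = b - 1
      · obtain ⟨rfl, rfl⟩ := h2
        simp
      · simp [h1, h2]

theorem closedProj_one_closedProj_two_qVec (i : B) (b : ℤ) {l : ℕ} (hl : l < σ.n b) :
    closedProj (threeSpaces 𝕜 σ v 1) (closedProj (threeSpaces 𝕜 σ v 2) (qVec σ v i b l)) =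
      σ.lam b l • qVec σ v i b l := by
  rw [closedProj_two_qVec 𝕜 σ hv i b hl, map_sub, closedProj_real_smul,
    closedProj_one_qVec 𝕜 σ hv, closedProj_one_nVec 𝕜 σ hv, smul_smul,
    Real.mul_self_sqrt (sub_nonneg.2 (σ.lam_le_one b l)), sub_smul, one_smul, sub_sub_cancel]

theorem closedProj_one_closedProj_two_eVec (i : B) (b : ℤ) :
    closedProj (threeSpaces 𝕜 σ v 1) (closedProj (threeSpaces 𝕜 σ v 2) (eVec σ v i b)) =
      eVec σ v i b + ∑ l ∈ Finset.range (σ.n b),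
        (√(σ.c b l) * Real.sin (σ.angle b l) * (1 - σ.lam b l)) • qVec σ v i b l -
      ∑ l ∈ Finset.range (σ.n (b - 1)),
        (√(σ.c (b - 1) l) * Real.cos (σ.angle (b - 1) l) * (1 - σ.lam (b - 1) l)) •
          qVec σ v i (b - 1) l := by
  have key : ∀ b (w : ℕ → ℝ), closedProj (threeSpaces 𝕜 σ v 1)
      (∑ l ∈ Finset.range (σ.n b), (√(1 - σ.lam b l) * w l) • nVec σ v i b l) =
      ∑ l ∈ Finset.range (σ.n b), (w l * (1 - σ.lam b l)) • qVec σ v i b l := by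
    intro b w
    rw [map_sum]
    refine Finset.sum_congr rfl fun l _ => ?_
    rw [closedProj_real_smul, closedProj_one_nVec 𝕜 σ hv, smul_smul]
    congr 1
    rw [mul_right_comm, Real.mul_self_sqrt (sub_nonneg.2 (σ.lam_le_one b l)), mul_comm]
  rw [closedProj_two_eVec 𝕜 σ hv, map_sub, map_add, closedProj_one_eVec 𝕜 σ hv, key, key]

omit [CompleteSpace H] in
theorem norm_eVec (i : B) (b : ℤ) : ‖eVec σ v i b‖ = 1 := by
  have h1 := inner_eVec_eVec 𝕜 σ hv i i b b
  rw [if_pos ⟨rfl, rfl⟩, inner_self_eq_norm_sq_to_K] at h1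
  have h2 : ‖eVec σ v i b‖ ^ 2 = 1 := by exact_mod_cast h1
  exact (pow_eq_one_iff_of_nonneg (norm_nonneg _) two_ne_zero).1 h2

theorem pathSystem_threeSpaces (i : B) :
    PathSystem σ (fun k => realProj (threeSpaces 𝕜 σ v k)) (eVec σ v i) (qVec σ v i) where
  norm_le k x := by
    rw [realProj_apply]
    exact norm_closedProj_le _ x
  norm_e b := norm_eVec 𝕜 σ hv i b
  one_le_norm_sub b b' hb := by
    have h1 := inner_eVec_eVec 𝕜 σ hv i i b b
    have h2 := inner_eVec_eVec 𝕜 σ hv i i b b'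
    rw [if_pos ⟨rfl, rfl⟩] at h1
    rw [if_neg fun h => hb h.2] at h2
    have h3 := norm_inner_le_norm (𝕜 := 𝕜) (eVec σ v i b) (eVec σ v i b - eVec σ v i b')
    rwa [inner_sub_right, h1, h2, sub_zero, norm_one, norm_eVec 𝕜 σ hv, one_mul] at h3
  f_e b := by
    simp only [realProj_apply]
    exact closedProj_zero_eVec 𝕜 σ i b
  f_q b _ hl := by
    simp only [realProj_apply]
    exact closedProj_zero_qVec 𝕜 σ hv i b hl
  g_q b _ hl := by
    simp only [realProj_apply]
    exact closedProj_one_closedProj_two_qVec 𝕜 σ hv i b hl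
  g_e b := by
    simp only [realProj_apply]
    exact closedProj_one_closedProj_two_eVec 𝕜 σ hv i b

end Construction

/-! ### Infinitely many copies inside a given Hilbert space -/

section Commutation

variable {𝕜 : Type u} {H : Type v} [RCLike 𝕜] [NormedAddCommGroup H] [InnerProductSpace 𝕜 H]
  [CompleteSpace H]

theorem closedProj_orthogonal_apply (X : ClosedSubmodule 𝕜 H) (x : H) :
    closedProj Xᗮ x = x - closedProj X x :=
  Submodule.starProjection_orthogonal_val x

theorem inner_closedProj_left (X : ClosedSubmodule 𝕜 H) (x y : H) :
    inner 𝕜 (closedProj X x) y = inner 𝕜 x (closedProj X y) :=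
  Submodule.inner_starProjection_left_eq_right _ x y

theorem closedProj_mem (X : ClosedSubmodule 𝕜 H) (x : H) : closedProj X x ∈ X :=
  Submodule.starProjection_apply_mem _ x

theorem closedProj_comm_of_mapsTo {S : Set H} {F : ClosedSubmodule 𝕜 H}
    (h : ∀ s ∈ S, closedProj F s ∈ Submodule.span 𝕜 S) (x : H) :
    closedProj (Submodule.span 𝕜 S).closure (closedProj F x) =
      closedProj F (closedProj (Submodule.span 𝕜 S).closure x) := by
  have hle : (Submodule.span 𝕜 S).closure ≤ (Submodule.span 𝕜 S).closure.comap (closedProj F) := by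
    rw [Submodule.closure_le, Submodule.span_le]
    exact fun s hs => Submodule.le_topologicalClosure _ (h s hs)
  refine Submodule.eq_starProjection_of_mem_of_inner_eq_zero (hle (closedProj_mem _ x)) ?_
  refine fun w hw => inner_eq_zero_of_mem_closure_span (fun s hs => ?_) hw
  rw [← map_sub, inner_closedProj_left]
  exact Submodule.starProjection_inner_eq_zero x _ (Submodule.le_topologicalClosure _ (h s hs))

theorem closedProj_orthogonal_comm_of_mapsTo {S : Set H} {F : ClosedSubmodule 𝕜 H}
    (h : ∀ s ∈ S, closedProj F s ∈ Submodule.span 𝕜 S) (x : H) :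
    closedProj (Submodule.span 𝕜 S).closureᗮ (closedProj F x) =
      closedProj F (closedProj (Submodule.span 𝕜 S).closureᗮ x) := by
  rw [closedProj_orthogonal_apply, closedProj_orthogonal_apply, closedProj_comm_of_mapsTo h,
    map_sub]

end Commutation

section Copies

variable {𝕜 : Type u} {H : Type v} [RCLike 𝕜] [NormedAddCommGroup H] [InnerProductSpace 𝕜 H]

/-- An infinite-dimensional Hilbert space has an orthonormal basis which splits into copies, indexed
by `B`, of a countable family, and there are as many copies as there are basis vectors. -/
theorem exists_total_orthonormal_copies [CompleteSpace H] (hH : ¬ FiniteDimensional 𝕜 H) :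
    ∃ (B : Type v) (v : B → Fin 4 → ℤ → ℕ → H) (τ : B × Fin 4 × ℤ × ℕ → B),
      Function.Injective τ ∧ (∀ z, (∀ i x b l, inner 𝕜 (v i x b l) z = 0) → z = 0) ∧
      Orthonormal 𝕜 (fun p : B × Fin 4 × ℤ × ℕ => v p.1 p.2.1 p.2.2.1 p.2.2.2) := by
  obtain ⟨w, β, -⟩ := exists_hilbertBasis 𝕜 H
  have hinf : Infinite w := by
    by_contra hfin
    rw [not_infinite_iff_finite] at hfin
    have := Fintype.ofFinite w
    exact hH (Module.Finite.of_basis β.toOrthonormalBasis.toBasis)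
  have hcard : Cardinal.mk (w × Fin 4 × ℤ × ℕ) = Cardinal.mk w := by
    rw [Cardinal.mk_prod, Cardinal.mk_eq_aleph0 (Fin 4 × ℤ × ℕ), Cardinal.lift_aleph0,
      Cardinal.lift_uzero]
    exact Cardinal.mul_aleph0_eq (Cardinal.aleph0_le_mk w)
  obtain ⟨E⟩ := Cardinal.eq.1 hcard
  refine ⟨w, fun i x b l => β (E (i, x, b, l)), E, E.injective, fun z hz => ?_, ?_⟩
  · apply β.repr.injective
    rw [map_zero]
    ext p
    rw [β.repr_apply_apply]
    obtain ⟨⟨i, x, b, l⟩, rfl⟩ := E.surjective p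
    exact hz i x b l
  · exact β.orthonormal.comp _ E.injective

end Copies

section Divergence

variable {𝕜 : Type u} {H : Type v} [RCLike 𝕜] [NormedAddCommGroup H] [InnerProductSpace 𝕜 H]
  {B : Type v} {v : B → Fin 4 → ℤ → ℕ → H}

variable (v) in
/-- The basis vectors of the copy `i`. -/
def copySet (i : B) : Set H := {x | ∃ y b l, x = v i y b l}

variable (v) in
/-- The starting vectors of all copies. -/
def startSet : Set H := {x | ∃ i, x = v i 2 0 0}

variable (v) in
/-- Pairwise sums of the basis vectors that are not starting vectors with distinct starting
vectors. -/
def pairSet (τ : B × Fin 4 × ℤ × ℕ → B) : Set H :=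
  {x | ∃ i y b l, ¬ (y = 2 ∧ b = 0 ∧ l = 0) ∧ x = v (τ (i, y, b, l)) 2 0 0 + v i y b l}

variable [DecidableEq B] (hv : ∀ i x b l i' x' b' l', inner 𝕜 (v i x b l) (v i' x' b' l') =
  if i = i' ∧ x = x' ∧ b = b' ∧ l = l' then (1 : 𝕜) else 0)
include hv

theorem inner_start_eq_zero {z : H} (hz : z ∈ (Submodule.span 𝕜 (startSet v)).closure) {i : B}
    {x : Fin 4} {b : ℤ} {l : ℕ} (h : ¬ (x = 2 ∧ b = 0 ∧ l = 0)) : inner 𝕜 (v i x b l) z = 0 := by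
  refine inner_eq_zero_of_mem_closure_span ?_ hz
  rintro _ ⟨j, rfl⟩
  rw [hv, if_neg fun h' => h h'.2]

variable [CompleteSpace H]

theorem closedProj_copy (i j : B) (x : Fin 4) (b : ℤ) (l : ℕ) :
    closedProj (Submodule.span 𝕜 (copySet v i)).closure (v j x b l) =
      if j = i then v j x b l else 0 := by
  split_ifs with h
  · subst h
    refine closedProj_closure_span_eq (Submodule.subset_span ⟨x, b, l, rfl⟩) fun s _ => ?_
    rw [sub_self, inner_zero_left]
  · refine closedProj_closure_span_eq (zero_mem _) ?_
    rintro _ ⟨y, b', l', rfl⟩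
    rw [sub_zero, hv, if_neg fun h' => h h'.1]

theorem closedProj_copy_of_mem_start (i : B) {w : H}
    (hw : w ∈ (Submodule.span 𝕜 (startSet v)).closure) :
    closedProj (Submodule.span 𝕜 (copySet v i)).closure w =
      inner 𝕜 (v i 2 0 0) w • v i 2 0 0 := by
  refine closedProj_closure_span_eq
    (Submodule.smul_mem _ _ (Submodule.subset_span ⟨2, 0, 0, rfl⟩)) ?_
  rintro _ ⟨y, b, l, rfl⟩
  rw [inner_sub_left, inner_smul_left, inner_conj_symm, hv]
  by_cases h : y = 2 ∧ b = 0 ∧ l = 0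
  · obtain ⟨rfl, rfl, rfl⟩ := h
    simp
  · rw [inner_eq_zero_symm.1 (inner_start_eq_zero hv hw h), if_neg, mul_zero, sub_zero]
    exact fun h' => h ⟨h'.2.1.symm, h'.2.2.1.symm, h'.2.2.2.symm⟩

variable (σ : Schedule)

theorem closedProj_copy_threeSpaces_comm [NormedSpace ℝ H] [IsScalarTower ℝ 𝕜 H] (i : B) (k : Fin 3)
    (x : H) :
    closedProj (threeSpaces 𝕜 σ v k)
        (closedProj (Submodule.span 𝕜 (copySet v i)).closure x) =
      closedProj (Submodule.span 𝕜 (copySet v i)).closure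
        (closedProj (threeSpaces 𝕜 σ v k) x) := by
  have hq : ∀ j b l, closedProj (Submodule.span 𝕜 (copySet v i)).closure (qVec σ v j b l) =
      if j = i then qVec σ v j b l else 0 := by
    intro j b l
    simp only [qVec, map_add, closedProj_real_smul, closedProj_copy hv]
    split_ifs <;> simp
  have hn : ∀ j b l, closedProj (Submodule.span 𝕜 (copySet v i)).closure (nVec σ v j b l) =
      if j = i then nVec σ v j b l else 0 := by
    intro j b l
    simp only [nVec, map_sub, closedProj_real_smul, closedProj_copy hv, hq]
    split_ifs <;> simp
  have he : ∀ j b, closedProj (Submodule.span 𝕜 (copySet v i)).closure (eVec σ v j b) =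
      if j = i then eVec σ v j b else 0 := by
    intro j b
    simp only [eVec, map_add, map_sum, closedProj_real_smul, closedProj_copy hv]
    split_ifs <;> simp
  have hspan : ∀ (S : Set H) (s : H) (p : Prop) [Decidable p], s ∈ S →
      (if p then s else 0) ∈ Submodule.span 𝕜 S := by
    intro S s p _ hs
    split_ifs
    · exact Submodule.subset_span hs
    · exact zero_mem _
  fin_cases k
  · refine closedProj_comm_of_mapsTo ?_ x
    rintro _ ⟨j, b, rfl⟩
    rw [he]
    exact hspan _ _ _ ⟨j, b, rfl⟩
  · refine closedProj_orthogonal_comm_of_mapsTo ?_ x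
    rintro _ ⟨j, b, l, rfl⟩
    rw [closedProj_copy hv]
    exact hspan _ _ _ ⟨j, b, l, rfl⟩
  · refine closedProj_orthogonal_comm_of_mapsTo ?_ x
    rintro _ ⟨j, b, l, hl, rfl⟩
    rw [hn]
    exact hspan _ _ _ ⟨j, b, l, hl, rfl⟩

omit hv [DecidableEq B] in
theorem projIterates_smul {ι : Type} (X : ι → ClosedSubmodule 𝕜 H) (k : ℕ → ι) (c : 𝕜) (x : H)
    (n : ℕ) : projIterates X k (c • x) n = c • projIterates X k x n := by
  induction n with
  | zero => rfl
  | succ n ih => rw [projIterates, ih, map_smul, projIterates]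

theorem not_convergesInNorm_of_mem_start [NormedSpace ℝ H] [IsScalarTower ℝ 𝕜 H] {k : ℕ → Fin 3}
    {t : ℕ → ℕ} (ht : StrictMono t) (ht0 : t 0 = 0)
    (hk : ∀ (V : Type v) (f : Fin 3 → V → V) (z : ℕ → V), (∀ n, z (n + 1) = f (k n) (z n)) →
      ∀ b : ℕ, z (t (b + 1)) = runWord f (σ.blockWord b) (z (t b)))
    {w : H} (hw : w ∈ (Submodule.span 𝕜 (startSet v)).closure) (hw0 : w ≠ 0) :
    ¬ ConvergesInNorm (projIterates (threeSpaces 𝕜 σ v) k w) := by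
  obtain ⟨i, hi⟩ : ∃ i, inner 𝕜 (v i 2 0 0) w ≠ 0 := by
    by_contra! h
    refine hw0 (inner_self_eq_zero (𝕜 := 𝕜).1 (inner_eq_zero_of_mem_closure_span ?_ hw))
    rintro _ ⟨i, rfl⟩
    exact inner_eq_zero_symm.1 (h i)
  set c := inner 𝕜 (v i 2 0 0) w
  -- Projecting the orbit of `w` to the copy `i` gives a multiple of the orbit of the starting vector.
  have hQ : ∀ n, closedProj (Submodule.span 𝕜 (copySet v i)).closure
      (projIterates (threeSpaces 𝕜 σ v) k w n) =
        c • projIterates (threeSpaces 𝕜 σ v) k (v i 2 0 0) n := by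
    intro n
    rw [← projIterates_smul]
    induction n with
    | zero => exact closedProj_copy_of_mem_start hv i hw
    | succ n ih => rw [projIterates, ← closedProj_copy_threeSpaces_comm hv, ih, projIterates]
  rintro ⟨y, hy⟩
  refine (pathSystem_threeSpaces 𝕜 σ hv i).not_tendsto
    (z := projIterates (threeSpaces 𝕜 σ v) k (v i 2 0 0)) ht (Real.sqrt_pos.2 (σ.rest_pos 0)) ?_ ?_
    ⟨c⁻¹ • closedProj (Submodule.span 𝕜 (copySet v i)).closure y, ?_⟩
  · rw [ht0, realProj_apply]
    exact closedProj_zero_two 𝕜 σ hv i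
  · exact hk H _ _ fun n => rfl
  · have h1 := (((closedProj (Submodule.span 𝕜 (copySet v i)).closure).continuous.tendsto y).comp
      hy).const_smul c⁻¹
    refine h1.congr fun n => ?_
    rw [Function.comp_apply, hQ, smul_smul, inv_mul_cancel₀ hi, one_smul]

/-- The projection onto the span of the paired sums maps no nonzero vector orthogonal to the
starting vectors into the orthogonal complement of the starting vectors. -/
theorem eq_zero_of_closedProj_pair {τ : B × Fin 4 × ℤ × ℕ → B} (hτ : Function.Injective τ)
    (htot : ∀ z, (∀ i x b l, inner 𝕜 (v i x b l) z = 0) → z = 0) {z : H}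
    (h1 : closedProj (Submodule.span 𝕜 (startSet v)).closure z = 0)
    (h2 : closedProj (Submodule.span 𝕜 (startSet v)).closure
      (closedProj (Submodule.span 𝕜 (pairSet v τ)).closure z) = 0) : z = 0 := by
  have horth : ∀ x, closedProj (Submodule.span 𝕜 (startSet v)).closure x = 0 →
      ∀ i, inner 𝕜 (v i 2 0 0) x = 0 := by
    intro x hx i
    have hfix : closedProj (Submodule.span 𝕜 (startSet v)).closure (v i 2 0 0) = v i 2 0 0 := by
      refine closedProj_closure_span_eq (Submodule.subset_span ⟨i, rfl⟩) fun s _ => ?_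
      rw [sub_self, inner_zero_left]
    rw [← hfix, inner_closedProj_left, hx, inner_zero_right]
  refine htot z fun i x b l => ?_
  by_cases hx : x = 2 ∧ b = 0 ∧ l = 0
  · obtain ⟨rfl, rfl, rfl⟩ := hx
    exact horth z h1 i
  · set j := τ (i, x, b, l) with hj
    have hpair : closedProj (Submodule.span 𝕜 (pairSet v τ)).closure (v j 2 0 0) =
        (1 / 2 : 𝕜) • (v j 2 0 0 + v i x b l) := by
      refine closedProj_closure_span_eq
        (Submodule.smul_mem _ _ (Submodule.subset_span ⟨i, x, b, l, hx, rfl⟩)) ?_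
      rintro _ ⟨i', x', b', l', hx', rfl⟩
      have e1 : v j 2 0 0 - (1 / 2 : 𝕜) • (v j 2 0 0 + v i x b l) =
          (1 / 2 : 𝕜) • (v j 2 0 0 - v i x b l) := by module
      have e2 : ∀ i'' , ¬ (i'' = i' ∧ 2 = x' ∧ 0 = b' ∧ 0 = l') := fun _ h =>
        hx' ⟨h.2.1.symm, h.2.2.1.symm, h.2.2.2.symm⟩
      have e3 : ∀ i'', ¬ (i = i'' ∧ x = 2 ∧ b = 0 ∧ l = 0) := fun _ h => hx h.2
      have e4 : j = τ (i', x', b', l') ↔ i = i' ∧ x = x' ∧ b = b' ∧ l = l' := by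
        rw [hj, hτ.eq_iff]
        simp
      rw [e1, inner_smul_left, inner_sub_left, inner_add_right, inner_add_right, hv, hv, hv, hv,
        if_neg (e2 _), if_neg (e3 _)]
      simp only [e4, and_true, add_zero, zero_add, sub_self, mul_zero]
    have h3 := horth _ h2 j
    rw [← inner_closedProj_left, hpair, inner_smul_left, inner_add_left, horth z h1 j,
      zero_add] at h3
    refine (mul_eq_zero.1 h3).resolve_left ?_
    simp

end Divergence

/-! ### The index sequence and the five subspaces -/

theorem exists_index_sequence :
    ∃ k : ℕ → Fin 3,
      ∀ (𝕜 : Type u) [RCLike 𝕜] (H : Type v) [NormedAddCommGroup H] [InnerProductSpace 𝕜 H]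
        [CompleteSpace H], ¬ FiniteDimensional 𝕜 H →
        ∃ (X Y : ClosedSubmodule 𝕜 H) (W : Fin 3 → ClosedSubmodule 𝕜 H), ∀ z : H, z ≠ 0 →
          ¬ ConvergesInNorm (projIterates W k (closedProj X z)) ∨
          ¬ ConvergesInNorm (projIterates W k (closedProj X (closedProj Y z))) := by
  classical
  obtain ⟨σ⟩ := exists_schedule
  obtain ⟨k, t, ht, ht0, hk⟩ :=
    exists_seq_of_words.{v} (fun b => σ.blockWord b) fun b => List.cons_ne_nil _ _
  refine ⟨k, fun 𝕜 _ H _ _ _ hH => ?_⟩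
  let _ : NormedSpace ℝ H := NormedSpace.restrictScalars ℝ 𝕜 H
  have : IsScalarTower ℝ 𝕜 H := IsScalarTower.of_algebraMap_smul fun r x => rfl
  obtain ⟨B, v, τ, hτ, htot, hort⟩ := exists_total_orthonormal_copies (𝕜 := 𝕜) hH
  have hv : ∀ i x b l i' x' b' l', inner 𝕜 (v i x b l) (v i' x' b' l') =
      if i = i' ∧ x = x' ∧ b = b' ∧ l = l' then (1 : 𝕜) else 0 := by
    intro i x b l i' x' b' l'
    have := orthonormal_iff_ite.1 hort (i, x, b, l) (i', x', b', l')
    simpa only [Prod.mk.injEq] using this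
  refine ⟨(Submodule.span 𝕜 (startSet v)).closure, (Submodule.span 𝕜 (pairSet v τ)).closure,
    threeSpaces 𝕜 σ v, fun z hz => ?_⟩
  -- If `z` is orthogonal to all starting vectors, the second orbit starts at a nonzero vector.
  by_cases h1 : closedProj (Submodule.span 𝕜 (startSet v)).closure z = 0
  · right
    refine not_convergesInNorm_of_mem_start hv σ ht ht0 hk (closedProj_mem _ _) fun h2 => hz ?_
    exact eq_zero_of_closedProj_pair hv hτ htot h1 h2
  · left
    exact not_convergesInNorm_of_mem_start hv σ ht ht0 hk (closedProj_mem _ _) h1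

theorem not_convergesInNorm_of_tail {𝕜 : Type u} {H : Type v} {ι : Type} [RCLike 𝕜]
    [NormedAddCommGroup H] [InnerProductSpace 𝕜 H] [CompleteSpace H] {X : ι → ClosedSubmodule 𝕜 H}
    {j k : ℕ → ι} (hj : ∀ n, j (n + 1) = k n) {z : H}
    (h : ¬ ConvergesInNorm (projIterates X k (closedProj (X (j 0)) z))) :
    ¬ ConvergesInNorm (projIterates X j z) := by
  rintro ⟨y, hy⟩
  refine h ⟨y, (hy.comp (tendsto_add_atTop_nat 1)).congr fun n => ?_⟩
  rw [Function.comp_apply]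
  induction n with
  | zero => rfl
  | succ n ih => rw [projIterates, ih, projIterates, hj]

theorem projIterates_comp {𝕜 : Type u} {H : Type v} {ι κ : Type} [RCLike 𝕜]
    [NormedAddCommGroup H] [InnerProductSpace 𝕜 H] [CompleteSpace H] (X : ι → ClosedSubmodule 𝕜 H)
    (g : κ → ι) (k : ℕ → κ) (z : H) :
    projIterates X (fun n => g (k n)) z = projIterates (fun j => X (g j)) k z := by
  funext n
  induction n with
  | zero => rfl
  | succ n ih => rw [projIterates, ih, projIterates]

theorem theorem3p3 :
    (∀ (𝕜 : Type u) [RCLike 𝕜] (H : Type v) [NormedAddCommGroup H] [InnerProductSpace 𝕜 H]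
        [CompleteSpace H], ¬ FiniteDimensional 𝕜 H →
        ∃ Z : Fin 5 → ClosedSubmodule 𝕜 H, ∀ z : H, z ≠ 0 →
          ∃ j : ℕ → Fin 5, ¬ ConvergesInNorm (projIterates Z j z)) ∧
    ∃ k : ℕ → Fin 3,
      ∀ (𝕜 : Type u) [RCLike 𝕜] (H : Type v) [NormedAddCommGroup H] [InnerProductSpace 𝕜 H]
        [CompleteSpace H], ¬ FiniteDimensional 𝕜 H →
        ∃ (X Y : ClosedSubmodule 𝕜 H) (W : Fin 3 → ClosedSubmodule 𝕜 H), ∀ z : H, z ≠ 0 →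
          ¬ ConvergesInNorm (projIterates W k (closedProj X z)) ∨
          ¬ ConvergesInNorm (projIterates W k (closedProj X (closedProj Y z))) := by
  refine ⟨fun 𝕜 _ H _ _ _ hH => ?_, exists_index_sequence⟩
  obtain ⟨k, hk⟩ := exists_index_sequence.{u, v}
  obtain ⟨X, Y, W, hXYW⟩ := hk 𝕜 H hH
  let Z : Fin 5 → ClosedSubmodule 𝕜 H := ![X, Y, W 0, W 1, W 2]
  let g : Fin 3 → Fin 5 := ![2, 3, 4]
  have hZ : (fun j => Z (g j)) = W := by
    funext j
    fin_cases j <;> rfl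
  have hW : ∀ x, projIterates Z (fun n => g (k n)) x = projIterates W k x := fun x => by
    rw [projIterates_comp, hZ]
  have hZ0 : Z 0 = X := rfl
  have hZ1 : Z 1 = Y := rfl
  let jX : ℕ → Fin 5 := fun n => Nat.casesOn n 0 fun m => g (k m)
  let jYX : ℕ → Fin 5 := fun n => Nat.casesOn n 1 jX
  have hX : ∀ x, ¬ ConvergesInNorm (projIterates W k (closedProj X x)) →
      ¬ ConvergesInNorm (projIterates Z jX x) := by
    intro x h
    refine not_convergesInNorm_of_tail (k := fun n => g (k n)) (fun n => rfl) ?_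
    rw [hW, show jX 0 = 0 from rfl, hZ0]
    exact h
  refine ⟨Z, fun z hz => ?_⟩
  rcases hXYW z hz with h | h
  · exact ⟨jX, hX z h⟩
  · refine ⟨jYX, not_convergesInNorm_of_tail (k := jX) (fun n => rfl) ?_⟩
    rw [show jYX 0 = 1 from rfl, hZ1]
    exact hX _ h
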